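/- Let $2^{<\omega}$ be the set of finite binary strings; for strings $\sigma,\tau$ let $|\sigma|$ be the length of $\sigma$ and $\sigma\wedge\tau$ the longest common initial segment. Let $\sigma<_{\mathbb Q}\tau$ mean that $\sigma$ is a proper initial segment of $\tau$ and $\tau(|\sigma|)=1$, or $\tau$ is a proper initial segment of $\sigma$ and $\sigma(|\tau|)=0$, or $\sigma,\tau$ are incomparable and $\sigma$ is lexicographically smaller than $\tau$. For a coloring $f:[\mathbb Q]^2\to k$, an $\ell$-solution to $f$ is a nonempty $S\subseteq\mathbb Q$ that is densely ordered without least or greatest element and satisfies $|f([S]^2)|\le \ell$. $\mathsf{DT}^2_{k,\ell}$ is the statement that every $f:[\mathbb Q]^2\to k$ has an $\ell$-solution. **Theorem.** 1. There is a computable coloring $f:[\mathbb Q]^2\to 4$ such that every $3$-solution to $f$ computes the halting set. (That is, there is a computable instance of $\mathsf{DT}^2_{4,3}$ all of whose solutions compute the halting set.) 2. Such a coloring is obtained explicitly as follows. There is a computable order isomorphism from $(\mathbb Q,<)$ onto $(2^{<\omega},<_{\mathbb Q})$. Let $e$ be any such isomorphism, let $K$ be any complete $\Sigma^0_1$ set,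 and let $(K_s)_{s\in\omega}$ be any computable enumeration of $K$ (a uniformly computable increasing sequence of sets with union $K$). For $\sigma<_{\mathbb Q}\tau$ let $f_{<_{\mathbb Q}}(\sigma,\tau)=1$ if $(|\sigma|<|\tau|\iff\sigma<_{\mathbb Q}\tau)$ and $f_{<_{\mathbb Q}}(\sigma,\tau)=0$ otherwise, and for $x,y,z\in\mathbb N$ let $f_J(x,y,z)=1$ if $K_y\cap\{0,\dots,x-1\}=K_z\cap\{0,\dots,x-1\}$ and $f_J(x,y,z)=0$ otherwise. Then the coloring of $[\mathbb Q]^2$ by the four elements of $\{0,1\}^2$ that gives a pair $p<q$, with $\sigma=e(p)$ and $\tau=e(q)$, the color $\langle f_{<_{\mathbb Q}}(\sigma,\tau),\,f_J(|\sigma\wedge\tau|,|\sigma|,|\tau|)\rangle$ is computable, and every $3$-solution to it computes the halting set. 3. Over $\mathsf{RCA}_0$, $\mathsf{DT}^2_{4,3}$ implies $\mathsf{ACA}_0$: every model $(N,\mathcal S)$ of $\mathsf{RCA}_0$ (with $N$ possibly nonstandard) that satisfies $\mathsf{DT}^2_{4,3}$ is a model of $\mathsf{ACA}_0$. -/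

import Mathlib

universe u

/-! ## Subsets of `ℕ`, Turing reducibility, the halting set -/

/-- The characteristic function of a set of natural numbers, as a (total) partial function. -/
noncomputable def charFun (A : Set ℕ) : ℕ →. ℕ := by
  classical
  exact fun n => Part.some (if n ∈ A then 1 else 0)

/-- `A` is Turing reducible to `B` (that is, `B` computes `A`). -/
def SetTuringReducible (A B : Set ℕ) : Prop :=
  TuringReducible (charFun A) (charFun B)

/-- The halting set: all `e` such that the `e`-th program halts on input `e`. -/
def haltingSet : Set ℕ :=
  {e | ((Denumerable.ofNat Nat.Partrec.Code e).eval e).Dom}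

/-- `K` is a complete `Σ⁰₁` set: it is c.e., and every c.e. set is many-one reducible to it. -/
def IsCompleteSigma1 (K : Set ℕ) : Prop :=
  REPred (fun n => n ∈ K) ∧
    ∀ B : Set ℕ, REPred (fun n => n ∈ B) → ManyOneReducible (fun n => n ∈ B) (fun n => n ∈ K)

/-- `(A s)` is a computable enumeration of `K`: a uniformly computable increasing sequence of sets
with union `K`. (Enumerations by finite sets are a special case.) -/
def IsComputableEnumeration (A : ℕ → Set ℕ) (K : Set ℕ) : Prop :=
  ComputablePred (fun p : ℕ × ℕ => p.2 ∈ A p.1) ∧ Monotone A ∧ ⋃ s, A s = K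

/-! ## Colorings of pairs of rationals -/

/-- The standard code of a rational number: numerator and denominator in lowest terms. -/
def ratCode (q : ℚ) : ℕ := Nat.pair (Encodable.encode q.num) q.den

/-- `S` computes `A`, where `S` is a set of rationals. -/
def RatSetComputes (S : Set ℚ) (A : Set ℕ) : Prop :=
  SetTuringReducible A (ratCode '' S)

/-- A coloring of `[ℚ]²` with `k` colors is given by a function `f`, the color of the pair `{p, q}`
with `p < q` being `f p q`; the values `f p q` for `p ≥ q` play no role. It is computable if the
color can be computed from the codes of `p` and `q`. -/
def IsComputableColoring {k : ℕ} (f : ℚ → ℚ → Fin k) : Prop :=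
  ∃ g : ℕ → ℕ → ℕ, Computable₂ g ∧
    ∀ p q : ℚ, p < q → g (ratCode p) (ratCode q) = (f p q : ℕ)

/-- The set of colors `f([S]²)`. -/
def colorsUsed {k : ℕ} (f : ℚ → ℚ → Fin k) (S : Set ℚ) : Set (Fin k) :=
  {c | ∃ p ∈ S, ∃ q ∈ S, p < q ∧ f p q = c}

/-- `S` is a solution to the instance `f` of Devlin's theorem for pairs with `k` colors and at most
`l` colors in the solution: a (nonempty) dense suborder of `ℚ` without endpoints on whose pairs at
most `l` colors occur. -/
def IsDevlinSolution {k : ℕ} (l : ℕ) (f : ℚ → ℚ → Fin k) (S : Set ℚ) : Prop :=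
  S.Nonempty ∧ DenselyOrdered S ∧ NoMinOrder S ∧ NoMaxOrder S ∧ (colorsUsed f S).ncard ≤ l

/-! ## Binary strings and the product coloring -/

/-- The meet of two binary strings: their longest common initial segment. -/
def meet : List Bool → List Bool → List Bool
  | a :: σ, b :: τ => if a = b then a :: meet σ τ else []
  | _, _ => []

/-- The dense linear order `<_ℚ` on binary strings. -/
def ltQ (σ τ : List Bool) : Prop :=
  (σ <+: τ ∧ τ[σ.length]? = some true) ∨
  (τ <+: σ ∧ σ[τ.length]? = some false) ∨
  (¬ σ <+: τ ∧ ¬ τ <+: σ ∧ σ < τ)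

/-- `e` is a computable isomorphism from `(ℚ, <)` onto the binary strings with `<_ℚ`. -/
def IsComputableStringIso (e : ℚ ≃ List Bool) : Prop :=
  (∀ p q : ℚ, p < q ↔ ltQ (e p) (e q)) ∧
    ∃ g : ℕ → List Bool, Computable g ∧ ∀ q : ℚ, g (ratCode q) = e q

/-- The embedding-type coloring takes the value `1` at `{σ, τ}` iff
`|σ| < |τ| ↔ σ <_ℚ τ`. -/
def EmbeddingTypeOne (σ τ : List Bool) : Prop :=
  σ.length < τ.length ↔ ltQ σ τ

/-- Jockusch's coloring takes the value `1` at `(x, y, z)` iff `A_y` and `A_z` agree below `x`. -/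
def JockuschOne (A : ℕ → Set ℕ) (x y z : ℕ) : Prop :=
  ∀ i < x, i ∈ A y ↔ i ∈ A z

/-- The product of the two colorings above: the color of `{σ, τ}` (with `σ <_ℚ τ`) is the pair of
the embedding-type color and of the Jockusch color of `(|σ ∧ τ|, |σ|, |τ|)`. The pair `⟨a, b⟩` of
elements of `{0, 1}` is written `2 * a + b`. -/
noncomputable def productColoring (A : ℕ → Set ℕ) (σ τ : List Bool) : Fin 4 := by
  classical
  exact (if EmbeddingTypeOne σ τ then 2 else 0) +
    (if JockuschOne A (meet σ τ).length σ.length τ.length then 1 else 0)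

/-! ## Second-order arithmetic -/

/-- Number terms of the language of second-order arithmetic, with number variables `x₀, x₁, …`. -/
inductive NumTerm : Type
  | var (n : ℕ)
  | zero
  | one
  | add (s t : NumTerm)
  | mul (s t : NumTerm)

/-- Arithmetical formulas: the formulas of the language of second-order arithmetic without set
quantifiers (free set variables `X₀, X₁, …` are allowed). Number quantifiers bind de Bruijn index
`0`; in the bounded quantifiers `x < t` the term `t` is outside the scope of the quantifier. -/
inductive ArithFormula : Type
  | eq (s t : NumTerm)
  | lt (s t : NumTerm)
  | mem (t : NumTerm) (X : ℕ)
  | not (φ : ArithFormula)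
  | and (φ ψ : ArithFormula)
  | or (φ ψ : ArithFormula)
  | allLt (t : NumTerm) (φ : ArithFormula)
  | exLt (t : NumTerm) (φ : ArithFormula)
  | all (φ : ArithFormula)
  | ex (φ : ArithFormula)

/-- The `Σ⁰₀` formulas: all quantifiers are bounded. -/
def ArithFormula.IsBounded : ArithFormula → Prop
  | .eq _ _ => True
  | .lt _ _ => True
  | .mem _ _ => True
  | .not φ => φ.IsBounded
  | .and φ ψ => φ.IsBounded ∧ ψ.IsBounded
  | .or φ ψ => φ.IsBounded ∧ ψ.IsBounded
  | .allLt _ φ => φ.IsBounded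
  | .exLt _ φ => φ.IsBounded
  | .all _ => False
  | .ex _ => False

/-- The `Σ⁰₁` formulas `∃ y θ` with `θ` bounded. -/
def ArithFormula.IsSigma1 (φ : ArithFormula) : Prop :=
  ∃ θ : ArithFormula, θ.IsBounded ∧ φ = .ex θ

/-- The `Π⁰₁` formulas `∀ y θ` with `θ` bounded. -/
def ArithFormula.IsPi1 (φ : ArithFormula) : Prop :=
  ∃ θ : ArithFormula, θ.IsBounded ∧ φ = .all θ

/-- The assignment that gives the value `x` to the variable `0` and shifts `v` by one. -/
def consVal {N : Type u} (x : N) (v : ℕ → N) : ℕ → N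
  | 0 => x
  | n + 1 => v n

section Semantics

variable {N : Type u} [CommSemiring N] [LinearOrder N]

def NumTerm.eval (v : ℕ → N) : NumTerm → N
  | .var n => v n
  | .zero => 0
  | .one => 1
  | .add s t => s.eval v + t.eval v
  | .mul s t => s.eval v * t.eval v

/-- Truth of an arithmetical formula under a number assignment `v` and a set assignment `V`. -/
def ArithFormula.Holds (V : ℕ → Set N) : ArithFormula → (ℕ → N) → Prop
  | .eq s t, v => s.eval v = t.eval v
  | .lt s t, v => s.eval v < t.eval v
  | .mem t X, v => t.eval v ∈ V X
  | .not φ, v => ¬ φ.Holds V v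
  | .and φ ψ, v => φ.Holds V v ∧ ψ.Holds V v
  | .or φ ψ, v => φ.Holds V v ∨ ψ.Holds V v
  | .allLt t φ, v => ∀ x : N, x < t.eval v → φ.Holds V (consVal x v)
  | .exLt t φ, v => ∃ x : N, x < t.eval v ∧ φ.Holds V (consVal x v)
  | .all φ, v => ∀ x : N, φ.Holds V (consVal x v)
  | .ex φ, v => ∃ x : N, φ.Holds V (consVal x v)

end Semantics

/-- The axioms of `PA⁻`: `N` is (the nonnegative part of) a discretely ordered ring. Together with
the commutative semiring and linear order axioms these say that the order is compatible with
addition and multiplication, `0 < 1`, `x ≤ y` iff `x + z = y` for some `z`, and there is nothing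
strictly between `0` and `1`. -/
class PAMinus (N : Type u) [CommSemiring N] [LinearOrder N] : Prop
    extends IsStrictOrderedRing N, CanonicallyOrderedAdd N where
  one_le_of_pos : ∀ x : N, 0 < x → 1 ≤ x

section Models

/- A model of second-order arithmetic is a pair `(N, 𝒮)`, where `N` interprets `0, 1, +, ·, <` and
`𝒮` is a collection of subsets of `N`, the range of the set variables. Nonstandard `N` are
allowed. -/

variable {N : Type u} [CommSemiring N] [LinearOrder N]

/-- `(N, 𝒮)` is a model of `RCA₀`: `PA⁻`, `Σ⁰₁` induction and `Δ⁰₁` comprehension, with number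
and set parameters. -/
structure ModelsRCA0 (𝒮 : Set (Set N)) : Prop where
  nonempty : 𝒮.Nonempty
  paMinus : PAMinus N
  sigma1_induction : ∀ φ : ArithFormula, φ.IsSigma1 →
    ∀ (V : ℕ → Set N) (v : ℕ → N), (∀ i, V i ∈ 𝒮) →
      φ.Holds V (consVal 0 v) →
      (∀ x : N, φ.Holds V (consVal x v) → φ.Holds V (consVal (x + 1) v)) →
      ∀ x : N, φ.Holds V (consVal x v)
  delta1_comprehension : ∀ φ ψ : ArithFormula, φ.IsSigma1 → ψ.IsPi1 →
    ∀ (V : ℕ → Set N) (v : ℕ → N), (∀ i, V i ∈ 𝒮) →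
      (∀ x : N, φ.Holds V (consVal x v) ↔ ψ.Holds V (consVal x v)) →
      {x : N | φ.Holds V (consVal x v)} ∈ 𝒮

/-- `(N, 𝒮)` is a model of `ACA₀`: a model of `RCA₀` with comprehension for all arithmetical
formulas. -/
structure ModelsACA0 (𝒮 : Set (Set N)) : Prop where
  rca0 : ModelsRCA0 𝒮
  arithmetical_comprehension : ∀ (φ : ArithFormula) (V : ℕ → Set N) (v : ℕ → N),
    (∀ i, V i ∈ 𝒮) → {x : N | φ.Holds V (consVal x v)} ∈ 𝒮

/-- The usual pairing function of second-order arithmetic. -/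
def pairN (i j : N) : N := (i + j) * (i + j) + i

/-- The code of the fraction `(a - b) / (c + 1)`. -/
def fracCode (a b c : N) : N := pairN (pairN a b) c

/-- `q` is a rational number of the model: rationals are identified with the least codes of
fractions among all codes of fractions of equal value. -/
def IsRatN (q : N) : Prop :=
  ∃ a b c : N, q = fracCode a b c ∧
    ∀ a' b' c' : N, a * (c' + 1) + b' * (c + 1) = a' * (c + 1) + b * (c' + 1) →
      q ≤ fracCode a' b' c'

/-- The order of the rational numbers of the model: `(a - b) / (c + 1) < (a' - b') / (c' + 1)`. -/
def ratLtN (q r : N) : Prop :=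
  ∃ a b c a' b' c' : N, q = fracCode a b c ∧ r = fracCode a' b' c' ∧
    a * (c' + 1) + b' * (c + 1) < a' * (c + 1) + b * (c' + 1)

/-- `F` is (the graph of) a coloring of the pairs of rationals of the model with colors `< k`; the
pair `{p, q}` with `p` less than `q` is coded by `pairN p q`. -/
def IsColoringN (k : ℕ) (F : Set N) : Prop :=
  ∀ p q : N, IsRatN p → IsRatN q → ratLtN p q →
    ∃ c : N, c < (k : N) ∧ ∀ d : N, pairN (pairN p q) d ∈ F ↔ d = c

/-- `S` is a nonempty dense suborder without endpoints of the rationals of the model. -/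
def IsDenseSuborderN (S : Set N) : Prop :=
  (∀ q ∈ S, IsRatN q) ∧ S.Nonempty ∧
    (∀ p ∈ S, ∀ q ∈ S, ratLtN p q → ∃ r ∈ S, ratLtN p r ∧ ratLtN r q) ∧
    (∀ q ∈ S, ∃ p ∈ S, ratLtN p q) ∧ (∀ q ∈ S, ∃ r ∈ S, ratLtN q r)

/-- `(N, 𝒮)` satisfies Devlin's theorem for pairs, `k` colors and at most `l` colors in the
solution: every coloring of the pairs of rationals with `k` colors has a dense suborder without
endpoints on whose pairs at most `l` colors occur. -/
def ModelsDT2 (𝒮 : Set (Set N)) (k l : ℕ) : Prop :=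
  ∀ F ∈ 𝒮, IsColoringN k F →
    ∃ S ∈ 𝒮, IsDenseSuborderN S ∧
      ∃ c : Fin l → N, ∀ p ∈ S, ∀ q ∈ S, ratLtN p q →
        ∀ d : N, pairN (pairN p q) d ∈ F → ∃ i : Fin l, d = c i

end Models

set_option linter.unusedSectionVars false

/-! ## Arithmetic in models of `PA⁻` -/

section Arithmetic

variable {N : Type u} [CommSemiring N] [LinearOrder N] [PAMinus N]

/-! A solution `S` to the product coloring omits a color, and the omitted color has Jockusch
component 0. Indeed, fix `ρ ∈ S` and choose `p < ρ < q` in `S` so long that the stages `|p|` and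
`|q|` are correct below `|ρ|`. The meet of `p` and `q` has length at most `|ρ|`, so the two stages
agree below it. Since `S` has arbitrarily long members on both sides of `ρ`, either of `p` and `q`
can be made the longer one, so Jockusch color 1 occurs with both embedding types. Hence, for one
embedding type, all pairs from `S` have Jockusch color 1.

Now let `p < q` in `S` have a meet longer than `i`. Choose `r ∈ S` between them, longer than both
the relevant endpoint and a stage by which `i`, if it is in `K`, has appeared. The meets of `r` with
`p` and with `q` are no shorter than that of `p` and `q`. For one embedding type the pair `p, r`
shows that stage `|p|` is correct at `i`; for the other the pair `r, q` shows this for `|q|`. So `S`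
decides `K` by searching for pairs with long meets (`IsDevlinSolution.mem_stage_iff`,
`SetTuringReducible.of_search`). The computable isomorphism comes from the Stern–Brocot tree.

In a model of `RCA₀` the strings are dispensed with. The meet is the shortest string in the closed
interval from `σ` to `τ`, so "`i` is below the length of the meet" says that no short string lies
there. Replacing lengths by codes of rationals gives the condition "no rational with code at most
`i` lies between `p` and `q`", and the same argument applies. Two facts need `Σ⁰₁` induction: the
existence of narrow intervals (`ModelsRCA0.exists_isNarrow`), and a stage correct below a given
number, which is strong `Σ⁰₁` bounding (`ModelsRCA0.exists_bound`). The set is then `Δ⁰₁` in `S`.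
Finally, `Σ⁰₁` comprehension is iterated along arithmetical formulas, with assignments coded by
iterated pairs (`ModelsACA0.of_sigma_comprehension`). -/

theorem PAMinus.add_one_le_of_lt {x y : N} (h : x < y) : x + 1 ≤ y := by
  obtain ⟨z, rfl⟩ := le_iff_exists_add.1 h.le
  have : 0 < z := by
    rcases eq_or_lt_of_le (zero_le (a := z)) with h0 | h0
    · simp [← h0] at h
    · exact h0
  gcongr
  exact PAMinus.one_le_of_pos z this

theorem PAMinus.lt_add_one_iff {x y : N} : x < y + 1 ↔ x ≤ y :=
  ⟨fun h => by
    by_contra hc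
    exact absurd (PAMinus.add_one_le_of_lt (not_le.1 hc)) (not_le.2 h),
   fun h => h.trans_lt (lt_add_one y)⟩

theorem PAMinus.le_mul_self (x : N) : x ≤ x * x := by
  rcases eq_or_lt_of_le (zero_le (a := x)) with h | h
  · simp [← h]
  · exact le_mul_of_one_le_left h.le (PAMinus.one_le_of_pos x h)

theorem le_pairN_left (i j : N) : i ≤ pairN i j := le_add_self

theorem le_pairN_right (i j : N) : j ≤ pairN i j :=
  (le_add_self.trans (PAMinus.le_mul_self (i + j))).trans le_self_add

/-- Pairs with sum `s` have codes from `s²` to `s² + s`, hence below `(s + 1)²`; the code therefore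
determines the sum. -/
theorem pairN_lt_of_add_lt {i j i' j' : N} (h : i + j < i' + j') : pairN i j < pairN i' j' := by
  have h1 := PAMinus.add_one_le_of_lt h
  have h2 : (i + j + 1) * (i + j + 1) ≤ (i' + j') * (i' + j') := by gcongr
  have h3 : pairN i j < (i + j + 1) * (i + j + 1) := by
    have : (i + j + 1) * (i + j + 1) = pairN i j + (i + j + j + 1) := by unfold pairN; ring
    rw [this, lt_add_iff_pos_right]
    exact lt_of_lt_of_le one_pos le_add_self
  exact (h3.trans_le h2).trans_le le_self_add

theorem pairN_injective {i j i' j' : N} (h : pairN i j = pairN i' j') : i = i' ∧ j = j' := by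
  have h1 : i + j = i' + j' := by
    rcases lt_trichotomy (i + j) (i' + j') with h1 | h1 | h1
    · exact absurd h (pairN_lt_of_add_lt h1).ne
    · exact h1
    · exact absurd h (pairN_lt_of_add_lt h1).ne'
  have h2 : i = i' := by
    unfold pairN at h
    rw [h1] at h
    exact add_left_cancel h
  subst h2
  exact ⟨rfl, add_left_cancel h1⟩

theorem fracCode_injective {a b c a' b' c' : N} (h : fracCode a b c = fracCode a' b' c') :
    a = a' ∧ b = b' ∧ c = c' := by
  obtain ⟨h1, h2⟩ := pairN_injective h
  obtain ⟨h3, h4⟩ := pairN_injective h1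
  exact ⟨h3, h4, h2⟩

theorem ratLtN.asymm {p q : N} (h : ratLtN p q) : ¬ ratLtN q p := by
  rintro ⟨a, b, c, a', b', c', rfl, rfl, h1⟩
  obtain ⟨x, y, z, x', y', z', h2, h3, h4⟩ := h
  obtain ⟨rfl, rfl, rfl⟩ := fracCode_injective h2
  obtain ⟨rfl, rfl, rfl⟩ := fracCode_injective h3
  refine lt_asymm h1 ?_
  rwa [add_comm (a * _), add_comm (a' * _)] at *

theorem ratLtN.trans {p q r : N} (h : ratLtN p q) (h' : ratLtN q r) : ratLtN p r := by
  obtain ⟨a, b, c, a', b', c', rfl, rfl, h1⟩ := h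
  obtain ⟨x, y, z, a₂, b₂, c₂, h2, rfl, h3⟩ := h'
  obtain ⟨rfl, rfl, rfl⟩ := fracCode_injective h2
  refine ⟨a, b, c, a₂, b₂, c₂, rfl, rfl, ?_⟩
  have pos : ∀ d : N, 0 < d + 1 := fun d => lt_of_lt_of_le one_pos le_add_self
  have h4 := mul_lt_mul_of_pos_right h1 (pos c₂)
  have h5 := mul_lt_mul_of_pos_right h3 (pos c)
  have h6 := add_lt_add h4 h5
  refine lt_of_mul_lt_mul_right (a := c' + 1) ?_ zero_le
  -- These are the terms of the middle fraction, which occur on both sides of the sum `h6`; they are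
  -- cancelled because subtraction is unavailable.
  refine lt_of_add_lt_add_right (a := a' * (c + 1) * (c₂ + 1) + b' * (c + 1) * (c₂ + 1)) ?_
  calc _ = _ := ?_
    _ < _ := h6
    _ = _ := ?_
  · ring
  · ring

end Arithmetic

/-! ## Predicates with bounded definitions -/

/-- The sequence `v 0, u 0, v 1, u 1, …`. -/
def interleave {α : Type*} (v u : ℕ → α) (i : ℕ) : α :=
  if i % 2 = 0 then v (i / 2) else u (i / 2)

@[simp] theorem interleave_even {α : Type*} (v u : ℕ → α) (i : ℕ) :
    interleave v u (2 * i) = v i := by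
  simp [interleave]

@[simp] theorem interleave_odd {α : Type*} (v u : ℕ → α) (i : ℕ) :
    interleave v u (2 * i + 1) = u i := by
  have h : (2 * i + 1) / 2 = i := by omega
  simp [interleave, h]

/-- A renaming of variables under one binder. -/
def liftVar (ρ : ℕ → ℕ) : ℕ → ℕ
  | 0 => 0
  | n + 1 => ρ n + 1

def NumTerm.rename (ρ : ℕ → ℕ) : NumTerm → NumTerm
  | .var n => .var (ρ n)
  | .zero => .zero
  | .one => .one
  | .add s t => .add (s.rename ρ) (t.rename ρ)
  | .mul s t => .mul (s.rename ρ) (t.rename ρ)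

/-- Renaming of number variables by `ρ` and of set variables by `κ`. -/
def ArithFormula.rename (κ : ℕ → ℕ) : (ℕ → ℕ) → ArithFormula → ArithFormula
  | ρ, .eq s t => .eq (s.rename ρ) (t.rename ρ)
  | ρ, .lt s t => .lt (s.rename ρ) (t.rename ρ)
  | ρ, .mem t X => .mem (t.rename ρ) (κ X)
  | ρ, .not φ => .not (φ.rename κ ρ)
  | ρ, .and φ ψ => .and (φ.rename κ ρ) (ψ.rename κ ρ)
  | ρ, .or φ ψ => .or (φ.rename κ ρ) (ψ.rename κ ρ)
  | ρ, .allLt t φ => .allLt (t.rename ρ) (φ.rename κ (liftVar ρ))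
  | ρ, .exLt t φ => .exLt (t.rename ρ) (φ.rename κ (liftVar ρ))
  | ρ, .all φ => .all (φ.rename κ (liftVar ρ))
  | ρ, .ex φ => .ex (φ.rename κ (liftVar ρ))

theorem ArithFormula.IsBounded.rename {φ : ArithFormula} (h : φ.IsBounded) (κ ρ : ℕ → ℕ) :
    (φ.rename κ ρ).IsBounded := by
  induction φ generalizing ρ with
  | eq | lt | mem => trivial
  | not φ ih => exact ih h ρ
  | and φ ψ ih ih' => exact ⟨ih h.1 ρ, ih' h.2 ρ⟩
  | or φ ψ ih ih' => exact ⟨ih h.1 ρ, ih' h.2 ρ⟩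
  | allLt t φ ih => exact ih h _
  | exLt t φ ih => exact ih h _
  | all | ex => exact h.elim

section Rename

variable {N : Type u}

theorem consVal_comp_liftVar (x : N) (v : ℕ → N) (ρ : ℕ → ℕ) :
    consVal x v ∘ liftVar ρ = consVal x (v ∘ ρ) := by
  funext i
  cases i <;> rfl

variable [CommSemiring N] [LinearOrder N]

theorem NumTerm.eval_rename (t : NumTerm) (ρ : ℕ → ℕ) (v : ℕ → N) :
    (t.rename ρ).eval v = t.eval (v ∘ ρ) := by
  induction t with
  | var | zero | one => rfl
  | add s t ihs iht => simp only [NumTerm.rename, NumTerm.eval, ihs, iht]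
  | mul s t ihs iht => simp only [NumTerm.rename, NumTerm.eval, ihs, iht]

theorem ArithFormula.holds_rename (φ : ArithFormula) (κ ρ : ℕ → ℕ) (V : ℕ → Set N) (v : ℕ → N) :
    (φ.rename κ ρ).Holds V v ↔ φ.Holds (V ∘ κ) (v ∘ ρ) := by
  induction φ generalizing ρ v with
  | eq | lt => simp only [rename, Holds, NumTerm.eval_rename]
  | mem => simp only [rename, Holds, NumTerm.eval_rename]; rfl
  | not φ ih => simp only [rename, Holds, ih]
  | and φ ψ ih ih' => simp only [rename, Holds, ih, ih']
  | or φ ψ ih ih' => simp only [rename, Holds, ih, ih']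
  | allLt t φ ih => simp only [rename, Holds, ih, NumTerm.eval_rename, consVal_comp_liftVar]
  | exLt t φ ih => simp only [rename, Holds, ih, NumTerm.eval_rename, consVal_comp_liftVar]
  | all φ ih => simp only [rename, Holds, ih, consVal_comp_liftVar]
  | ex φ ih => simp only [rename, Holds, ih, consVal_comp_liftVar]

end Rename

section BoundedDef

variable {N : Type u} [CommSemiring N] [LinearOrder N]

/-- `t` is a polynomial, with parameters, in the entries of the sequence to which it is applied. -/
def PolyFun (t : (ℕ → N) → N) : Prop :=
  ∃ (τ : NumTerm) (u : ℕ → N), ∀ v, t v = τ.eval (interleave v u)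

/-- `P` is defined by a `Σ⁰₀` formula with number parameters and set parameters from `𝒮`. -/
def BoundedDef (𝒮 : Set (Set N)) (P : (ℕ → N) → Prop) : Prop :=
  ∃ (θ : ArithFormula) (V : ℕ → Set N) (u : ℕ → N), θ.IsBounded ∧ (∀ i, V i ∈ 𝒮) ∧
    ∀ v, P v ↔ θ.Holds V (interleave v u)

/-- Even indices stay, odd ones are sent to the parameters of the first of two parameter
sequences. -/
def fstParam (i : ℕ) : ℕ := if i % 2 = 0 then 2 * i / 2 else 2 * (2 * (i / 2)) + 1

/-- Even indices stay, odd ones are sent to the parameters of the second of two parameter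
sequences. -/
def sndParam (i : ℕ) : ℕ := if i % 2 = 0 then 2 * i / 2 else 2 * (2 * (i / 2) + 1) + 1

theorem interleave_comp_fstParam (v u u' : ℕ → N) :
    interleave v (interleave u u') ∘ fstParam = interleave v u := by
  funext i
  rcases Nat.mod_two_eq_zero_or_one i with h | h
  · simp [fstParam, interleave, h]
  · simp only [fstParam, Function.comp, h, one_ne_zero, if_false, interleave_odd, interleave_even]
    simp [interleave, h]

theorem interleave_comp_sndParam (v u u' : ℕ → N) :
    interleave v (interleave u u') ∘ sndParam = interleave v u' := by
  funext i
  rcases Nat.mod_two_eq_zero_or_one i with h | h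
  · simp [sndParam, interleave, h]
  · simp only [sndParam, Function.comp, h, one_ne_zero, if_false, interleave_odd]
    simp [interleave, h]

namespace PolyFun

theorem var (i : ℕ) : PolyFun (fun v : ℕ → N => v i) :=
  ⟨.var (2 * i), fun _ => 0, fun v => by simp [NumTerm.eval]⟩

theorem const (c : N) : PolyFun (fun _ : ℕ → N => c) :=
  ⟨.var 1, fun _ => c, fun v => (interleave_odd v (fun _ => c) 0).symm⟩

theorem add {s t : (ℕ → N) → N} (hs : PolyFun s) (ht : PolyFun t) :
    PolyFun (fun v => s v + t v) := by
  obtain ⟨σ, u, hσ⟩ := hs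
  obtain ⟨τ, u', hτ⟩ := ht
  exact ⟨.add (σ.rename fstParam) (τ.rename sndParam), interleave u u', fun v => by
    simp only [NumTerm.eval, NumTerm.eval_rename, interleave_comp_fstParam,
      interleave_comp_sndParam, hσ, hτ]⟩

theorem mul {s t : (ℕ → N) → N} (hs : PolyFun s) (ht : PolyFun t) :
    PolyFun (fun v => s v * t v) := by
  obtain ⟨σ, u, hσ⟩ := hs
  obtain ⟨τ, u', hτ⟩ := ht
  exact ⟨.mul (σ.rename fstParam) (τ.rename sndParam), interleave u u', fun v => by
    simp only [NumTerm.eval, NumTerm.eval_rename, interleave_comp_fstParam,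
      interleave_comp_sndParam, hσ, hτ]⟩

theorem pairN {s t : (ℕ → N) → N} (hs : PolyFun s) (ht : PolyFun t) :
    PolyFun (fun v => pairN (s v) (t v)) :=
  ((hs.add ht).mul (hs.add ht)).add hs

theorem fracCode {r s t : (ℕ → N) → N} (hr : PolyFun r) (hs : PolyFun s) (ht : PolyFun t) :
    PolyFun (fun v => fracCode (r v) (s v) (t v)) :=
  (hr.pairN hs).pairN ht

end PolyFun

namespace BoundedDef

variable {𝒮 : Set (Set N)} {P Q : (ℕ → N) → Prop} {s t : (ℕ → N) → N}

theorem congr (h : BoundedDef 𝒮 P) (hPQ : ∀ v, Q v ↔ P v) : BoundedDef 𝒮 Q := by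
  rwa [show Q = P from funext fun v => propext (hPQ v)]

theorem mem {A : Set N} (hA : A ∈ 𝒮) (ht : PolyFun t) : BoundedDef 𝒮 (fun v => t v ∈ A) := by
  obtain ⟨τ, u, hτ⟩ := ht
  exact ⟨.mem τ 0, fun _ => A, u, trivial, fun _ => hA, fun v => by
    simp only [ArithFormula.Holds, hτ]⟩

theorem eq (hne : 𝒮.Nonempty) (hs : PolyFun s) (ht : PolyFun t) :
    BoundedDef 𝒮 (fun v => s v = t v) := by
  obtain ⟨A, hA⟩ := hne
  obtain ⟨σ, u, hσ⟩ := hs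
  obtain ⟨τ, u', hτ⟩ := ht
  exact ⟨.eq (σ.rename fstParam) (τ.rename sndParam), fun _ => A, interleave u u', trivial,
    fun _ => hA, fun v => by
    simp only [ArithFormula.Holds, NumTerm.eval_rename, interleave_comp_fstParam,
      interleave_comp_sndParam, hσ, hτ]⟩

theorem lt (hne : 𝒮.Nonempty) (hs : PolyFun s) (ht : PolyFun t) :
    BoundedDef 𝒮 (fun v => s v < t v) := by
  obtain ⟨A, hA⟩ := hne
  obtain ⟨σ, u, hσ⟩ := hs
  obtain ⟨τ, u', hτ⟩ := ht
  exact ⟨.lt (σ.rename fstParam) (τ.rename sndParam), fun _ => A, interleave u u', trivial,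
    fun _ => hA, fun v => by
    simp only [ArithFormula.Holds, NumTerm.eval_rename, interleave_comp_fstParam,
      interleave_comp_sndParam, hσ, hτ]⟩

theorem not (h : BoundedDef 𝒮 P) : BoundedDef 𝒮 (fun v => ¬ P v) := by
  obtain ⟨θ, V, u, hθ, hV, h⟩ := h
  exact ⟨.not θ, V, u, hθ, hV, fun v => not_congr (h v)⟩

theorem interleave_comp_even (V V' : ℕ → Set N) : interleave V V' ∘ (fun i => 2 * i) = V :=
  funext fun i => interleave_even V V' i

theorem interleave_comp_odd (V V' : ℕ → Set N) : interleave V V' ∘ (fun i => 2 * i + 1) = V' :=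
  funext fun i => interleave_odd V V' i

theorem interleave_mem {V V' : ℕ → Set N} (hV : ∀ i, V i ∈ 𝒮) (hV' : ∀ i, V' i ∈ 𝒮) (i : ℕ) :
    interleave V V' i ∈ 𝒮 := by
  unfold interleave
  split_ifs
  exacts [hV _, hV' _]

theorem and (hP : BoundedDef 𝒮 P) (hQ : BoundedDef 𝒮 Q) : BoundedDef 𝒮 (fun v => P v ∧ Q v) := by
  obtain ⟨θ, V, u, hθ, hV, h⟩ := hP
  obtain ⟨θ', V', u', hθ', hV', h'⟩ := hQ
  exact ⟨.and (θ.rename (fun i => 2 * i) fstParam) (θ'.rename (fun i => 2 * i + 1) sndParam),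
    interleave V V', interleave u u', ⟨hθ.rename _ _, hθ'.rename _ _⟩, interleave_mem hV hV',
    fun v => by
      simp only [ArithFormula.Holds, ArithFormula.holds_rename, interleave_comp_even,
        interleave_comp_odd, interleave_comp_fstParam, interleave_comp_sndParam, h, h']⟩

theorem or (hP : BoundedDef 𝒮 P) (hQ : BoundedDef 𝒮 Q) : BoundedDef 𝒮 (fun v => P v ∨ Q v) :=
  (hP.not.and hQ.not).not.congr fun v => by tauto

theorem imp (hP : BoundedDef 𝒮 P) (hQ : BoundedDef 𝒮 Q) : BoundedDef 𝒮 (fun v => P v → Q v) :=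
  (hP.and hQ.not).not.congr fun v => by tauto

theorem iff (hP : BoundedDef 𝒮 P) (hQ : BoundedDef 𝒮 Q) : BoundedDef 𝒮 (fun v => P v ↔ Q v) :=
  ((hP.imp hQ).and (hQ.imp hP)).congr fun v => by tauto

/-- The renaming that moves the variables of a sequence interleaved with parameters when one
more variable is bound. -/
def bindParam : ℕ → ℕ
  | 0 => 0
  | i + 1 => if i % 2 = 0 then i + 2 else i

theorem consVal_comp_bindParam (x : N) (v u : ℕ → N) :
    consVal x (interleave v u) ∘ bindParam = interleave (consVal x v) u := by
  funext i
  match i with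
  | 0 => rfl
  | i + 1 =>
    rcases Nat.even_or_odd' i with ⟨j, rfl | rfl⟩
    · simp [bindParam, consVal]
    · have : (2 * j + 1) % 2 = 1 := by omega
      simp only [Function.comp, bindParam, this, one_ne_zero, if_false]
      rw [show 2 * j + 1 + 1 = 2 * (j + 1) by ring, interleave_even]
      simp [consVal]

theorem consVal_zero (x : N) (v : ℕ → N) : consVal x v 0 = x := rfl

theorem consVal_succ (x : N) (v : ℕ → N) (i : ℕ) : consVal x v (i + 1) = v i := rfl

theorem exLt {R : N → (ℕ → N) → Prop} (ht : PolyFun t)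
    (h : BoundedDef 𝒮 (fun w => R (w 0) (fun i => w (i + 1)))) :
    BoundedDef 𝒮 (fun v => ∃ x, x < t v ∧ R x v) := by
  obtain ⟨τ, u, hτ⟩ := ht
  obtain ⟨θ, V, u', hθ, hV, h⟩ := h
  -- `bindParam` adapts `θ` to a bound variable in front of the interleaved sequence; `liftVar
  -- sndParam` then selects the second half of the merged parameters and leaves the bound variable
  -- alone.
  refine ⟨.exLt (τ.rename fstParam) ((θ.rename id bindParam).rename id (liftVar sndParam)), V,
    interleave u u', (hθ.rename _ _).rename _ _, hV, fun v => ?_⟩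
  simp only [ArithFormula.Holds, ArithFormula.holds_rename, NumTerm.eval_rename,
    interleave_comp_fstParam, consVal_comp_liftVar, interleave_comp_sndParam,
    consVal_comp_bindParam, Function.comp_id, ← h, ← hτ, consVal_zero, consVal_succ]

theorem allLt {R : N → (ℕ → N) → Prop} (ht : PolyFun t)
    (h : BoundedDef 𝒮 (fun w => R (w 0) (fun i => w (i + 1)))) :
    BoundedDef 𝒮 (fun v => ∀ x, x < t v → R x v) :=
  (exLt (R := fun x v => ¬ R x v) ht h.not).not.congr fun v => by push Not; rfl

end BoundedDef

end BoundedDef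

section BoundedRel

variable {N : Type u} [CommSemiring N] [LinearOrder N]

/-- Weakening: a term from outside a quantifier is used inside its scope. -/
theorem PolyFun.shift {t : (ℕ → N) → N} (ht : PolyFun t) :
    PolyFun (fun w => t (fun i => w (i + 1))) := by
  obtain ⟨τ, u, hτ⟩ := ht
  refine ⟨τ.rename fun i => if i % 2 = 0 then i + 2 else i, u, fun v => ?_⟩
  rw [NumTerm.eval_rename]
  refine (hτ _).trans ?_
  congr 1
  funext i
  rcases Nat.even_or_odd' i with ⟨j, rfl | rfl⟩
  · simp only [Function.comp, Nat.mul_mod_right, if_true, interleave_even]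
    rw [show 2 * j + 2 = 2 * (j + 1) by ring, interleave_even]
  · have : (2 * j + 1) % 2 = 1 := by omega
    simp [this]

/-- The binary relation `R` has a bounded definition with parameters. -/
def BoundedRel (𝒮 : Set (Set N)) (R : N → N → Prop) : Prop :=
  ∀ i j : ℕ, BoundedDef 𝒮 (fun v => R (v i) (v j))

/-- `Δ⁰₁` comprehension evaluates both of its formulas under one assignment, so the parameters of
the two definitions are merged. -/
theorem BoundedDef.exists_holds {𝒮 : Set (Set N)} {R Q : N → N → Prop}
    (hR : BoundedDef 𝒮 (fun v => R (v 0) (v 1))) (hQ : BoundedDef 𝒮 (fun v => Q (v 0) (v 1))) :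
    ∃ (θ θ' : ArithFormula) (V : ℕ → Set N) (u : ℕ → N), θ.IsBounded ∧ θ'.IsBounded ∧
      (∀ i, V i ∈ 𝒮) ∧ (∀ y x, R y x ↔ θ.Holds V (consVal y (consVal x u))) ∧
      ∀ y x, Q y x ↔ θ'.Holds V (consVal y (consVal x u)) := by
  obtain ⟨θ, V, u, hθ, hV, h⟩ := hR
  obtain ⟨θ', V', u', hθ', hV', h'⟩ := hQ
  -- Positions 0 and 1 hold `y` and `x`, position 2 holds a dummy 0 for all argument variables that
  -- do not matter, and the parameters start at position 3.
  let ρ : ℕ → ℕ := fun i => if i % 2 = 1 then i / 2 + 3 else if i = 0 then 0 else if i = 2 then 1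
    else 2
  let w := consVal 0 (interleave u u')
  have key : ∀ y x, consVal y (consVal x w) ∘ ρ =
      interleave (consVal y (consVal x fun _ => 0)) (interleave u u') := by
    intro y x
    funext i
    rcases Nat.even_or_odd' i with ⟨j, rfl | rfl⟩
    · rw [interleave_even]
      match j with
      | 0 => rfl
      | 1 => rfl
      | j + 2 =>
        have : (2 * (j + 2)) ≠ 2 := by omega
        simp [ρ, this, w, consVal]
    · have h1 : (2 * j + 1) / 2 = j := by omega
      have h2 : (2 * j + 1) % 2 = 1 := by omega
      rw [interleave_odd]
      simp [ρ, h1, h2, w, consVal]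
  refine ⟨(θ.rename (fun i => 2 * i) fstParam).rename id ρ,
    (θ'.rename (fun i => 2 * i + 1) sndParam).rename id ρ, interleave V V', w,
    (hθ.rename _ _).rename _ _, (hθ'.rename _ _).rename _ _, interleave_mem hV hV', ?_, ?_⟩
  · intro y x
    rw [ArithFormula.holds_rename, ArithFormula.holds_rename, Function.comp_id, key,
      interleave_comp_even, interleave_comp_fstParam, ← h]
    rfl
  · intro y x
    rw [ArithFormula.holds_rename, ArithFormula.holds_rename, Function.comp_id, key,
      interleave_comp_odd, interleave_comp_sndParam, ← h']
    rfl

end BoundedRel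

/-! ### Induction and comprehension for predicates with bounded definitions -/

namespace ModelsRCA0

variable {N : Type u} [CommSemiring N] [LinearOrder N] {𝒮 : Set (Set N)}

theorem induction (hM : ModelsRCA0 𝒮) {R : N → N → Prop} (hR : BoundedRel 𝒮 R)
    (zero : ∃ y, R y 0) (succ : ∀ x, (∃ y, R y x) → ∃ y, R y (x + 1)) (x : N) : ∃ y, R y x := by
  obtain ⟨θ, _, V, u, hθ, _, hV, h, _⟩ := (hR 0 1).exists_holds (hR 0 1)
  have := hM.sigma1_induction (.ex θ) ⟨θ, hθ, rfl⟩ V u hV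
  simp only [ArithFormula.Holds, ← h] at this
  exact this zero succ x

theorem delta_comprehension (hM : ModelsRCA0 𝒮) {R Q : N → N → Prop} (hR : BoundedRel 𝒮 R)
    (hQ : BoundedRel 𝒮 Q) (h : ∀ x, (∃ y, R y x) ↔ ∀ y, Q y x) : {x | ∃ y, R y x} ∈ 𝒮 := by
  obtain ⟨θ, θ', V, u, hθ, hθ', hV, h1, h2⟩ := (hR 0 1).exists_holds (hQ 0 1)
  have := hM.delta1_comprehension (.ex θ) (.all θ') ⟨θ, hθ, rfl⟩ ⟨θ', hθ', rfl⟩ V u hV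
  simp only [ArithFormula.Holds, ← h1, ← h2] at this
  exact this h

theorem bounded_comprehension (hM : ModelsRCA0 𝒮) {P : N → Prop}
    (hP : ∀ i, BoundedDef 𝒮 (fun v => P (v i))) : {x | P x} ∈ 𝒮 := by
  have hR : BoundedRel 𝒮 (fun _ x => P x) := fun _ j => hP j
  have := hM.delta_comprehension hR hR fun x => ⟨fun ⟨_, h⟩ _ => h, fun h => ⟨0, h 0⟩⟩
  simpa using this

end ModelsRCA0

/-! ### Coprime moduli and strong `Σ⁰₁` bounding -/

section Divisibility

variable {N : Type u} [CommSemiring N] [LinearOrder N] [PAMinus N]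

theorem dvd_iff_exists_lt {a b : N} : a ∣ b ↔ ∃ k, k < b + 1 ∧ b = a * k := by
  constructor
  · rintro ⟨k, rfl⟩
    rcases eq_or_lt_of_le (zero_le (a := a)) with h | h
    -- For `a = 0` the given cofactor need not be bounded by `b`, but 0 serves as well.
    · exact ⟨0, lt_of_lt_of_le one_pos le_add_self, by simp [← h]⟩
    · exact ⟨k, PAMinus.lt_add_one_iff.2 (le_mul_of_one_le_left zero_le (PAMinus.one_le_of_pos a h)),
        rfl⟩
  · rintro ⟨k, -, rfl⟩
    exact dvd_mul_right a k

theorem BoundedDef.dvd {𝒮 : Set (Set N)} (hne : 𝒮.Nonempty) {s t : (ℕ → N) → N} (hs : PolyFun s)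
    (ht : PolyFun t) : BoundedDef 𝒮 (fun v => s v ∣ t v) := by
  refine BoundedDef.congr ?_ fun v => dvd_iff_exists_lt
  exact .exLt (ht.add (.const 1)) (.eq hne ht.shift (hs.shift.mul (.var 0)))

theorem PAMinus.dvd_of_dvd_add {a b c : N} (hb : a ∣ b) (h : a ∣ b + c) : a ∣ c := by
  obtain ⟨B, rfl⟩ := hb
  obtain ⟨A, hA⟩ := h
  rcases eq_or_lt_of_le (zero_le (a := a)) with ha | ha
  · rw [← ha, zero_mul, zero_mul, zero_add] at hA
    simp [hA]
  · have hBA : B ≤ A := le_of_mul_le_mul_left (hA ▸ le_self_add) ha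
    obtain ⟨E, rfl⟩ := le_iff_exists_add.1 hBA
    refine ⟨E, add_left_cancel (a := a * B) ?_⟩
    rw [hA, mul_add]

/-- The moduli `1 + (i + 1) d`, for `i < n`, are relatively prime if all positive numbers below `n`
divide `d`. -/
theorem PAMinus.dvd_of_dvd_modulus_mul {d n i j x : N} (hd : ∀ g, g < n → 0 < g → g ∣ d) (hi : i < n)
    (hj : j < n) (hij : i ≠ j) (h : (1 + (j + 1) * d) ∣ (1 + (i + 1) * d) * x) :
    (1 + (j + 1) * d) ∣ x := by
  -- Take `g = |i - j|`: the combination `(j + 1)(1 + (i + 1)d) - (i + 1)(1 + (j + 1)d)` equals `j -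
  -- i`.
  have key : ∃ g, g < n ∧ 0 < g ∧ (1 + (j + 1) * d) ∣ g * x := by
    rcases lt_or_gt_of_ne hij with hlt | hlt
    · obtain ⟨g, rfl⟩ := le_iff_exists_add.1 hlt.le
      refine ⟨g, lt_of_le_of_lt le_add_self hj, (lt_add_iff_pos_right i).1 hlt, ?_⟩
      refine dvd_of_dvd_add (b := (1 + (i + g + 1) * d) * ((i + 1) * x)) (dvd_mul_right _ _) ?_
      convert h.mul_left (i + g + 1) using 1
      ring
    · obtain ⟨g, rfl⟩ := le_iff_exists_add.1 hlt.le
      refine ⟨g, lt_of_le_of_lt le_add_self hi, (lt_add_iff_pos_right j).1 hlt, ?_⟩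
      refine dvd_of_dvd_add (b := (j + 1) * ((1 + (j + g + 1) * d) * x)) (h.mul_left _) ?_
      refine ⟨(j + g + 1) * x, ?_⟩
      ring
  obtain ⟨g, hgn, hg, h1⟩ := key
  obtain ⟨e, rfl⟩ := hd g hgn hg
  -- With `d = g * e`, `x` is the difference of `(1 + (j + 1)d)x` and `(j + 1)dx`, both multiples of
  -- the modulus.
  refine dvd_of_dvd_add (b := (j + 1) * (g * e) * x) ?_ ⟨x, by ring⟩
  convert h1.mul_left ((j + 1) * e) using 1
  ring

/-- A substitute for the factorial: multiplying by `n` in the induction step needs only a bounded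
divisibility condition, not a definition of the factorial function. -/
theorem ModelsRCA0.exists_dvd {𝒮 : Set (Set N)} (hM : ModelsRCA0 𝒮) (n : N) :
    ∃ d : N, 0 < d ∧ ∀ g, g < n → 0 < g → g ∣ d := by
  have hne := hM.nonempty
  refine hM.induction (R := fun d n => 0 < d ∧ ∀ g, g < n → 0 < g → g ∣ d) ?_ ?_ ?_ n
  · intro i j
    apply_rules [BoundedDef.and, BoundedDef.allLt, BoundedDef.imp, BoundedDef.dvd, BoundedDef.lt,
      PolyFun.var, PolyFun.const]
  · exact ⟨1, one_pos, fun g hg => absurd hg (not_lt.2 zero_le)⟩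
  · rintro n ⟨d, hd, h⟩
    -- For `n = 0` the product `d * n` would vanish, so this case is separate.
    rcases eq_or_lt_of_le (zero_le (a := n)) with hn | hn
    · refine ⟨1, one_pos, fun g hg hg' => absurd (PAMinus.lt_add_one_iff.1 hg) ?_⟩
      rw [← hn]
      exact not_le.2 hg'
    · refine ⟨d * n, mul_pos hd hn, fun g hg hg' => ?_⟩
      rcases (PAMinus.lt_add_one_iff.1 hg).eq_or_lt with rfl | h1
      · exact dvd_mul_left _ _
      · exact (h g h1 hg').mul_right n

/-- The product of the moduli. A number `c` is read as a code of the set of `i` whose modulus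
divides it, and `C` codes everything below `n`. -/
theorem ModelsRCA0.exists_modulus_dvd {𝒮 : Set (Set N)} (hM : ModelsRCA0 𝒮) (d n : N) :
    ∃ C : N, 0 < C ∧ ∀ i, i < n → (1 + (i + 1) * d) ∣ C := by
  have hne := hM.nonempty
  refine hM.induction (R := fun C n => 0 < C ∧ ∀ i, i < n → (1 + (i + 1) * d) ∣ C) ?_ ?_ ?_ n
  · intro i j
    apply_rules [BoundedDef.and, BoundedDef.allLt, BoundedDef.imp, BoundedDef.dvd, BoundedDef.lt,
      PolyFun.var, PolyFun.const, PolyFun.add, PolyFun.mul]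
  · exact ⟨1, one_pos, fun g hg => absurd hg (not_lt.2 zero_le)⟩
  · rintro n ⟨C, hC, h⟩
    refine ⟨C * (1 + (n + 1) * d), mul_pos hC (lt_of_lt_of_le one_pos le_self_add), fun i hi => ?_⟩
    rcases (PAMinus.lt_add_one_iff.1 hi).eq_or_lt with rfl | h1
    · exact dvd_mul_left _ _
    · exact (h i h1).mul_right _

/-- Strong `Σ⁰₁` bounding. -/
theorem ModelsRCA0.exists_bound {𝒮 : Set (Set N)} (hM : ModelsRCA0 𝒮) {R : N → N → Prop}
    (hR : BoundedRel 𝒮 R) (n : N) : ∃ s, ∀ i, i < n → (∃ y, R y i) → ∃ y, y < s ∧ R y i := by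
  have hne := hM.nonempty
  obtain ⟨d, hd0, hd⟩ := hM.exists_dvd n
  obtain ⟨C, hC0, hC⟩ := hM.exists_modulus_dvd d n
  by_contra! hcon
  -- If no bound exists, new indices keep acquiring witnesses. So no positive `c` codes a set
  -- containing all indices with a witness below every `s`; induction on `c` finds a suitable `s`,
  -- and `c = C` is absurd.
  suffices h : ∀ x, ∃ s, ∀ c, c < x → 0 < c →
      ∃ i, i < n ∧ (∃ y, y < s ∧ R y i) ∧ ¬ (1 + (i + 1) * d) ∣ c by
    obtain ⟨s, hs⟩ := h (C + 1)
    obtain ⟨i, hi, -, h1⟩ := hs C (lt_add_one C) hC0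
    exact h1 (hC i hi)
  refine hM.induction (R := fun s x => ∀ c, c < x → 0 < c →
      ∃ i, i < n ∧ (∃ y, y < s ∧ R y i) ∧ ¬ (1 + (i + 1) * d) ∣ c) ?_ ?_ ?_
  · intro i j
    have hR' : ∀ i j : ℕ, BoundedDef 𝒮 (fun v => R (v i) (v j)) := hR
    apply_rules [BoundedDef.not, BoundedDef.and, BoundedDef.allLt, BoundedDef.exLt, BoundedDef.imp,
      BoundedDef.dvd, BoundedDef.lt, PolyFun.var, PolyFun.const, PolyFun.add, PolyFun.mul]
  · exact ⟨0, fun c hc => absurd hc (not_lt.2 zero_le)⟩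
  · rintro x ⟨s, hs⟩
    obtain ⟨i, hi, ⟨y, hy⟩, his⟩ := hcon s
    have hmono : ∀ j, (∃ z, z < s ∧ R z j) → ∃ z, z < max s (y + 1) ∧ R z j :=
      fun j ⟨z, hz, h⟩ => ⟨z, lt_max_of_lt_left hz, h⟩
    refine ⟨max s (y + 1), fun c hc hc0 => ?_⟩
    rcases (PAMinus.lt_add_one_iff.1 hc).eq_or_lt with rfl | hc'
    · by_cases hic : (1 + (i + 1) * d) ∣ c
      -- The index `i` has no witness below `s`, so it may be removed from the set coded by `c`: the
      -- quotient `c'` is smaller, and the index `j` it misses differs from `i`. By coprimality `c`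
      -- misses `j` too.
      · obtain ⟨c', rfl⟩ := hic
        have hc0' : 0 < c' := pos_of_mul_pos_right hc0 zero_le
        have hlt : c' < (1 + (i + 1) * d) * c' := by
          rw [add_mul, one_mul, lt_add_iff_pos_right]
          exact mul_pos (mul_pos (lt_of_lt_of_le one_pos le_add_self) hd0) hc0'
        obtain ⟨j, hj, hj', hjc⟩ := hs c' hlt hc0'
        refine ⟨j, hj, hmono j hj', fun hdvd => hjc ?_⟩
        refine PAMinus.dvd_of_dvd_modulus_mul hd hi hj ?_ hdvd
        rintro rfl
        obtain ⟨z, hz, hz'⟩ := hj'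
        exact his z hz hz'
      · exact ⟨i, hi, ⟨y, lt_max_of_lt_right (lt_add_one y), hy⟩, hic⟩
    · obtain ⟨j, hj, hj', hjc⟩ := hs c hc' hc0
      exact ⟨j, hj, hmono j hj', hjc⟩

end Divisibility

/-! ### Narrow intervals and the coloring inside a model -/

section RationalsOfModel

variable {N : Type u} [CommSemiring N] [LinearOrder N] [PAMinus N] {𝒮 : Set (Set N)}

theorem le_fracCode (a b c : N) :
    a ≤ fracCode a b c ∧ b ≤ fracCode a b c ∧ c ≤ fracCode a b c :=
  ⟨(le_pairN_left a b).trans (le_pairN_left _ c), (le_pairN_right a b).trans (le_pairN_left _ c),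
    le_pairN_right _ c⟩

/-- The entries of a fraction are at most its code, so all six quantifiers can be bounded. -/
theorem BoundedRel.ratLtN (hne : 𝒮.Nonempty) : BoundedRel 𝒮 (ratLtN (N := N)) := by
  have key : ∀ q r : N, _root_.ratLtN q r ↔
      ∃ a, a < q + 1 ∧ ∃ b, b < q + 1 ∧ ∃ c, c < q + 1 ∧
      ∃ a', a' < r + 1 ∧ ∃ b', b' < r + 1 ∧ ∃ c', c' < r + 1 ∧
        q = fracCode a b c ∧ r = fracCode a' b' c' ∧
        a * (c' + 1) + b' * (c + 1) < a' * (c + 1) + b * (c' + 1) := by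
    intro q r
    constructor
    · rintro ⟨a, b, c, a', b', c', rfl, rfl, h⟩
      obtain ⟨h1, h2, h3⟩ := le_fracCode a b c
      obtain ⟨h4, h5, h6⟩ := le_fracCode a' b' c'
      simp only [PAMinus.lt_add_one_iff]
      exact ⟨a, h1, b, h2, c, h3, a', h4, b', h5, c', h6, rfl, rfl, h⟩
    · rintro ⟨a, -, b, -, c, -, a', -, b', -, c', -, h1, h2, h⟩
      exact ⟨a, b, c, a', b', c', h1, h2, h⟩
  intro i j
  refine BoundedDef.congr ?_ fun v => key (v i) (v j)
  have hb : ∀ k : ℕ, PolyFun (fun v : ℕ → N => v k + 1) := fun k => (PolyFun.var k).add (.const 1)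
  refine .exLt (hb _) (.exLt (hb _) (.exLt (hb _) (.exLt (hb _) (.exLt (hb _) (.exLt (hb _) ?_)))))
  refine .and (.eq hne (.var _) (.fracCode (.var _) (.var _) (.var _))) (.and (.eq hne (.var _)
    (.fracCode (.var _) (.var _) (.var _))) (.lt hne ?_ ?_))
  · exact ((PolyFun.var _).mul (hb _)).add ((PolyFun.var _).mul (hb _))
  · exact ((PolyFun.var _).mul (hb _)).add ((PolyFun.var _).mul (hb _))

/-- `σ < τ` and no rational with a code below `x` lies between `σ` and `τ`. -/
def IsNarrow (x σ τ : N) : Prop :=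
  ratLtN σ τ ∧ ∀ r, r < x → ¬ (ratLtN σ r ∧ ratLtN r τ)

/-- `Σ⁰₁` induction on `x`: a point `ρ ∈ S` splits the interval, and `x` lies strictly inside at
most one of the halves, so the other half can be kept. -/
theorem ModelsRCA0.exists_isNarrow (hM : ModelsRCA0 𝒮) {S : Set N} (hS : S ∈ 𝒮)
    (hd : IsDenseSuborderN S) {p q : N} (hp : p ∈ S) (hq : q ∈ S) (hpq : ratLtN p q) (x : N) :
    ∃ σ ∈ S, ∃ τ ∈ S, (p = σ ∨ ratLtN p σ) ∧ (τ = q ∨ ratLtN τ q) ∧ IsNarrow x σ τ := by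
  have hne := hM.nonempty
  have hlt : ∀ i j : ℕ, BoundedDef 𝒮 (fun v : ℕ → N => ratLtN (v i) (v j)) := BoundedRel.ratLtN hne
  have hlt1 : ∀ i : ℕ, BoundedDef 𝒮 (fun v : ℕ → N => p = v i ∨ ratLtN p (v i)) := fun i => by
    -- `BoundedRel` concerns variables only, so the parameter `p` enters as a bounded variable equal
    -- to it.
    refine BoundedDef.congr (P := fun v => p = v i ∨ ∃ y, y < p + 1 ∧ y = p ∧ ratLtN y (v i)) ?_
      fun v => ?_
    · apply_rules [BoundedDef.and, BoundedDef.or, BoundedDef.exLt, BoundedDef.eq, PolyFun.var,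
        PolyFun.const]
    · simp
  have hlt2 : ∀ i : ℕ, BoundedDef 𝒮 (fun v : ℕ → N => v i = q ∨ ratLtN (v i) q) := fun i => by
    refine BoundedDef.congr (P := fun v => v i = q ∨ ∃ y, y < q + 1 ∧ y = q ∧ ratLtN (v i) y) ?_
      fun v => ?_
    · apply_rules [BoundedDef.and, BoundedDef.or, BoundedDef.exLt, BoundedDef.eq, PolyFun.var,
        PolyFun.const]
    · simp
  have main : ∃ y, ∃ σ, σ < y ∧ ∃ τ, τ < y ∧ σ ∈ S ∧ τ ∈ S ∧ (p = σ ∨ ratLtN p σ) ∧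
      (τ = q ∨ ratLtN τ q) ∧ ratLtN σ τ ∧ ∀ r, r < x → ¬ (ratLtN σ r ∧ ratLtN r τ) := by
    refine hM.induction (R := fun y x => ∃ σ, σ < y ∧ ∃ τ, τ < y ∧ σ ∈ S ∧ τ ∈ S ∧
      (p = σ ∨ ratLtN p σ) ∧ (τ = q ∨ ratLtN τ q) ∧ ratLtN σ τ ∧
      ∀ r, r < x → ¬ (ratLtN σ r ∧ ratLtN r τ)) ?_ ?_ ?_ x
    · intro i j
      have hmem : ∀ i, BoundedDef 𝒮 (fun v : ℕ → N => v i ∈ S) := fun i => .mem hS (.var i)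
      exact .exLt (.var _) (.exLt (.var _) (.and (hmem _) (.and (hmem _) (.and (hlt1 _)
        (.and (hlt2 _) (.and (hlt _ _) (.allLt (.var _) (.not (.and (hlt _ _) (hlt _ _))))))))))
    · exact ⟨p + q + 1, p, PAMinus.lt_add_one_iff.2 le_self_add, q,
        PAMinus.lt_add_one_iff.2 le_add_self, hp, hq, .inl rfl, .inl rfl, hpq,
        fun r hr => absurd hr (not_lt.2 zero_le)⟩
    · rintro x ⟨y, σ, hσy, τ, hτy, hσ, hτ, hpσ, hτq, hστ, h⟩
      obtain ⟨ρ, hρ, hσρ, hρτ⟩ := hd.2.2.1 σ hσ τ hτ hστ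
      by_cases hx : ratLtN x ρ
      · refine ⟨y + ρ + 1, ρ, PAMinus.lt_add_one_iff.2 le_add_self, τ,
          hτy.trans_le (le_self_add.trans le_self_add), hρ, hτ,
          .inr (hpσ.elim (fun e => e ▸ hσρ) fun e => e.trans hσρ), hτq, hρτ, fun r hr ⟨h1, h2⟩ => ?_⟩
        rcases (PAMinus.lt_add_one_iff.1 hr).eq_or_lt with rfl | hr
        · exact h1.asymm hx
        · exact h r hr ⟨hσρ.trans h1, h2⟩
      · refine ⟨y + ρ + 1, σ, hσy.trans_le (le_self_add.trans le_self_add), ρ,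
          PAMinus.lt_add_one_iff.2 le_add_self, hσ, hρ, hpσ,
          .inr (hτq.elim (fun e => e ▸ hρτ) fun e => hρτ.trans e), hσρ, fun r hr ⟨h1, h2⟩ => ?_⟩
        rcases (PAMinus.lt_add_one_iff.1 hr).eq_or_lt with rfl | hr
        · exact hx h2
        · exact h r hr ⟨h1, h2.trans hρτ⟩
  obtain ⟨y, σ, -, τ, -, h1, h2, h3, h4, h5⟩ := main
  exact ⟨σ, h1, τ, h2, h3, h4, h5⟩

/-- Inside an interval that is narrow for `n + 1`, every member of `S` has code above `n`. -/
theorem ModelsRCA0.exists_between_large (hM : ModelsRCA0 𝒮) {S : Set N} (hS : S ∈ 𝒮)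
    (hd : IsDenseSuborderN S) {p q : N} (hp : p ∈ S) (hq : q ∈ S) (hpq : ratLtN p q) (n : N) :
    ∃ ρ ∈ S, ratLtN p ρ ∧ ratLtN ρ q ∧ n < ρ := by
  obtain ⟨σ, hσ, τ, hτ, hpσ, hτq, hστ, h⟩ := hM.exists_isNarrow hS hd hp hq hpq (n + 1)
  obtain ⟨ρ, hρ, h1, h2⟩ := hd.2.2.1 σ hσ τ hτ hστ
  refine ⟨ρ, hρ, hpσ.elim (fun e => e ▸ h1) fun e => e.trans h1,
    hτq.elim (fun e => e ▸ h2) fun e => h2.trans e, ?_⟩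
  by_contra hc
  exact h ρ (PAMinus.lt_add_one_iff.2 (not_lt.1 hc)) ⟨h1, h2⟩

theorem ModelsRCA0.exists_lt_large (hM : ModelsRCA0 𝒮) {S : Set N} (hS : S ∈ 𝒮)
    (hd : IsDenseSuborderN S) {q : N} (hq : q ∈ S) (n : N) : ∃ p ∈ S, ratLtN p q ∧ n < p := by
  obtain ⟨p, hp, hpq⟩ := hd.2.2.2.1 q hq
  obtain ⟨ρ, hρ, -, h1, h2⟩ := hM.exists_between_large hS hd hp hq hpq n
  exact ⟨ρ, hρ, h1, h2⟩

theorem ModelsRCA0.exists_gt_large (hM : ModelsRCA0 𝒮) {S : Set N} (hS : S ∈ 𝒮)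
    (hd : IsDenseSuborderN S) {p : N} (hp : p ∈ S) (n : N) : ∃ q ∈ S, ratLtN p q ∧ n < q := by
  obtain ⟨q, hq, hpq⟩ := hd.2.2.2.2 p hp
  obtain ⟨ρ, hρ, h1, -, h2⟩ := hM.exists_between_large hS hd hp hq hpq n
  exact ⟨ρ, hρ, h1, h2⟩

/-- The stage `s` of the enumeration of `{i | ∃ y, R y i}`. -/
def StageN (R : N → N → Prop) (s i : N) : Prop := ∃ y, y < s ∧ R y i

/-- The stages `p` and `q` agree on the numbers `i < p + q` such that no rational with a code
at most `i` lies between `p` and `q`. -/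
def StagesAgree (R : N → N → Prop) (p q : N) : Prop :=
  ∀ i, i < p + q → (∀ r, r < i + 1 → ¬ (ratLtN p r ∧ ratLtN r q)) → (StageN R p i ↔ StageN R q i)

/-- The color of the pair `{p, q}` is `2 a + b`, where `a = 1` if the orders of the codes and of the
rationals agree, and `b = 1` if the stages agree. -/
def HasColorN (R : N → N → Prop) (p q d : N) : Prop :=
  (p < q ∧ StagesAgree R p q ∧ d = 3) ∨ (p < q ∧ ¬ StagesAgree R p q ∧ d = 2) ∨
    (¬ p < q ∧ StagesAgree R p q ∧ d = 1) ∨ (¬ p < q ∧ ¬ StagesAgree R p q ∧ d = 0)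

/-- The bounds by `z + 1` lose nothing, since components are at most their pair; they make the
definition bounded, so that the graph lies in the model. -/
def colorGraphN (R : N → N → Prop) : Set N :=
  {z | ∃ p, p < z + 1 ∧ ∃ q, q < z + 1 ∧ ∃ d, d < z + 1 ∧ z = pairN (pairN p q) d ∧
    HasColorN R p q d}

theorem mem_colorGraphN {R : N → N → Prop} {p q d : N} :
    pairN (pairN p q) d ∈ colorGraphN R ↔ HasColorN R p q d := by
  constructor
  · rintro ⟨p', -, q', -, d', -, h, h'⟩
    obtain ⟨h1, rfl⟩ := pairN_injective h
    obtain ⟨rfl, rfl⟩ := pairN_injective h1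
    exact h'
  · intro h
    simp only [colorGraphN, Set.mem_ofPred_eq, PAMinus.lt_add_one_iff]
    exact ⟨p, (le_pairN_left p q).trans (le_pairN_left _ d), q,
      (le_pairN_right p q).trans (le_pairN_left _ d), d, le_pairN_right _ d, rfl, h⟩

theorem isColoringN_colorGraphN (R : N → N → Prop) : IsColoringN 4 (colorGraphN R) := by
  intro p q _ _ _
  have h4 : ∀ k : ℕ, k < 4 → (k : N) < ((4 : ℕ) : N) := fun k hk => Nat.cast_lt.2 hk
  simp only [mem_colorGraphN]
  by_cases h1 : p < q <;> by_cases h2 : StagesAgree R p q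
  · exact ⟨3, by simpa using h4 3 (by norm_num), fun d => by simp [HasColorN, h1, h2]⟩
  · exact ⟨2, by simpa using h4 2 (by norm_num), fun d => by simp [HasColorN, h1, h2]⟩
  · exact ⟨1, by simp, fun d => by simp [HasColorN, h1, h2]⟩
  · exact ⟨0, by simp, fun d => by simp [HasColorN, h1, h2]⟩

theorem BoundedRel.stageN {R : N → N → Prop} (hR : BoundedRel 𝒮 R) : BoundedRel 𝒮 (StageN R) :=
  fun _ _ => .exLt (.var _) (hR _ _)

theorem BoundedRel.stagesAgree (hne : 𝒮.Nonempty) {R : N → N → Prop} (hR : BoundedRel 𝒮 R) :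
    BoundedRel 𝒮 (StagesAgree R) := fun _ _ =>
  .allLt (.add (.var _) (.var _)) (.imp (.allLt (.add (.var _) (.const _))
    (.not (.and (BoundedRel.ratLtN hne _ _) (BoundedRel.ratLtN hne _ _))))
    (.iff (hR.stageN _ _) (hR.stageN _ _)))

theorem ModelsRCA0.colorGraphN_mem (hM : ModelsRCA0 𝒮) {R : N → N → Prop}
    (hR : BoundedRel 𝒮 R) : colorGraphN R ∈ 𝒮 := by
  have hne := hM.nonempty
  have hagree : ∀ i j : ℕ, BoundedDef 𝒮 (fun v => StagesAgree R (v i) (v j)) :=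
    BoundedRel.stagesAgree hne hR
  have hcolor : ∀ i j k : ℕ, BoundedDef 𝒮 (fun v => HasColorN R (v i) (v j) (v k)) := by
    intro i j k
    have hlt : BoundedDef 𝒮 (fun v : ℕ → N => v i < v j) := .lt hne (.var i) (.var j)
    have heq : ∀ c : N, BoundedDef 𝒮 (fun v => v k = c) := fun c => .eq hne (.var k) (.const c)
    exact .or (.and hlt (.and (hagree i j) (heq 3))) (.or (.and hlt (.and (hagree i j).not (heq 2)))
      (.or (.and hlt.not (.and (hagree i j) (heq 1))) (.and hlt.not (.and (hagree i j).not (heq 0)))))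
  refine hM.bounded_comprehension fun i => ?_
  apply_rules [BoundedDef.and, BoundedDef.exLt, BoundedDef.eq, PolyFun.var, PolyFun.const,
    PolyFun.pairN, PolyFun.add]

variable {R : N → N → Prop} {S : Set N}

/-- A number `i` relevant to a pair around `ρ` is below `ρ`. Beyond the bound `s` for the witnesses
of such numbers all stages are correct, and whichever endpoint is chosen second can be given the
larger code. -/
theorem ModelsRCA0.exists_stagesAgree (hM : ModelsRCA0 𝒮) (hR : BoundedRel 𝒮 R) (hS : S ∈ 𝒮)
    (hd : IsDenseSuborderN S) :
    (∃ p ∈ S, ∃ q ∈ S, ratLtN p q ∧ p < q ∧ StagesAgree R p q) ∧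
      ∃ p ∈ S, ∃ q ∈ S, ratLtN p q ∧ ¬ p < q ∧ StagesAgree R p q := by
  obtain ⟨ρ, hρ⟩ := hd.2.1
  obtain ⟨s, hs⟩ := hM.exists_bound hR ρ
  have key : ∀ p q, s < p → s < q → ratLtN p ρ → ratLtN ρ q → StagesAgree R p q := by
    intro p q hp hq hpρ hρq i _ hi
    have hiρ : i < ρ := by
      by_contra hc
      exact hi ρ (PAMinus.lt_add_one_iff.2 (not_lt.1 hc)) ⟨hpρ, hρq⟩
    constructor
    · rintro ⟨y, -, hy⟩
      obtain ⟨y', h1, h2⟩ := hs i hiρ ⟨y, hy⟩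
      exact ⟨y', h1.trans hq, h2⟩
    · rintro ⟨y, -, hy⟩
      obtain ⟨y', h1, h2⟩ := hs i hiρ ⟨y, hy⟩
      exact ⟨y', h1.trans hp, h2⟩
  constructor
  · obtain ⟨p, hp, hpρ, hsp⟩ := hM.exists_lt_large hS hd hρ s
    obtain ⟨q, hq, hρq, hpq⟩ := hM.exists_gt_large hS hd hρ p
    exact ⟨p, hp, q, hq, hpρ.trans hρq, hpq, key p q hsp (hsp.trans hpq) hpρ hρq⟩
  · obtain ⟨q, hq, hρq, hsq⟩ := hM.exists_gt_large hS hd hρ s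
    obtain ⟨p, hp, hpρ, hqp⟩ := hM.exists_lt_large hS hd hρ q
    exact ⟨p, hp, q, hq, hpρ.trans hρq, hqp.not_gt, key p q (hsq.trans hqp) hsq hpρ hρq⟩

/-- If the stages agree for all pairs from `S` of one order type, then the stage given by one
endpoint of a narrow interval is correct. -/
theorem ModelsRCA0.stageN_iff_of_isNarrow (hM : ModelsRCA0 𝒮) (hS : S ∈ 𝒮)
    (hd : IsDenseSuborderN S) :
    ((∀ p ∈ S, ∀ q ∈ S, ratLtN p q → p < q → StagesAgree R p q) →
      ∀ i, ∀ σ ∈ S, ∀ τ ∈ S, IsNarrow (i + 1) σ τ → (StageN R σ i ↔ ∃ y, R y i)) ∧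
    ((∀ p ∈ S, ∀ q ∈ S, ratLtN p q → ¬ p < q → StagesAgree R p q) →
      ∀ i, ∀ σ ∈ S, ∀ τ ∈ S, IsNarrow (i + 1) σ τ → (StageN R τ i ↔ ∃ y, R y i)) := by
  constructor <;> intro hagree i σ hσ τ hτ hn <;> refine ⟨fun ⟨y, _, h⟩ => ⟨y, h⟩, fun ⟨y, h⟩ => ?_⟩
  -- Codes above `i + y + σ` secure three things: `i` is in the range tested by the coloring, the
  -- witness `y` is visible at stage `ρ`, and the pair has the right order type.
  · obtain ⟨ρ, hρ, h1, h2, h3⟩ := hM.exists_between_large hS hd hσ hτ hn.1 (i + y + σ)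
    refine (hagree σ hσ ρ hρ h1 (lt_of_le_of_lt le_add_self h3) i ?_ ?_).2 ⟨y, ?_, h⟩
    · exact (lt_of_le_of_lt (le_self_add.trans le_self_add) h3).trans_le le_add_self
    · exact fun r hr ⟨h4, h5⟩ => hn.2 r hr ⟨h4, h5.trans h2⟩
    · exact lt_of_le_of_lt (le_add_self.trans le_self_add) h3
  · obtain ⟨ρ, hρ, h1, h2, h3⟩ := hM.exists_between_large hS hd hσ hτ hn.1 (i + y + τ)
    refine (hagree ρ hρ τ hτ h2 (lt_of_le_of_lt le_add_self h3).not_gt i ?_ ?_).1 ⟨y, ?_, h⟩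
    · exact (lt_of_le_of_lt (le_self_add.trans le_self_add) h3).trans_le le_self_add
    · exact fun r hr ⟨h4, h5⟩ => hn.2 r hr ⟨h1.trans h4, h5⟩
    · exact lt_of_le_of_lt (le_add_self.trans le_self_add) h3

/-- A set is in the model if its members are decided by the narrow intervals of `S`. -/
theorem ModelsRCA0.mem_of_isNarrow (hM : ModelsRCA0 𝒮) (hS : S ∈ 𝒮) (hd : IsDenseSuborderN S)
    {A : Set N} {D : N → N → N → Prop}
    (hD : ∀ i j k, BoundedDef 𝒮 (fun v => D (v i) (v j) (v k)))
    (h : ∀ i, ∀ σ ∈ S, ∀ τ ∈ S, IsNarrow (i + 1) σ τ → (D σ τ i ↔ i ∈ A)) : A ∈ 𝒮 := by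
  have hne := hM.nonempty
  have hlt : ∀ i j : ℕ, BoundedDef 𝒮 (fun v : ℕ → N => ratLtN (v i) (v j)) := BoundedRel.ratLtN hne
  have hmem : ∀ i, BoundedDef 𝒮 (fun v : ℕ → N => v i ∈ S) := fun i => .mem hS (.var i)
  have hpair : ∀ i : N, ∃ y, ∃ σ, σ < y ∧ ∃ τ, τ < y ∧ σ ∈ S ∧ τ ∈ S ∧ IsNarrow (i + 1) σ τ := by
    intro i
    obtain ⟨p, hp⟩ := hd.2.1
    obtain ⟨q, hq, hpq⟩ := hd.2.2.2.2 p hp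
    obtain ⟨σ, hσ, τ, hτ, -, -, hn⟩ := hM.exists_isNarrow hS hd hp hq hpq (i + 1)
    exact ⟨σ + τ + 1, σ, PAMinus.lt_add_one_iff.2 le_self_add, τ,
      PAMinus.lt_add_one_iff.2 le_add_self, hσ, hτ, hn⟩
  -- All narrow pairs give the same verdict, so "some pair says yes" and "every pair says yes" are
  -- `Σ⁰₁` and `Π⁰₁` forms of membership; `y` only bounds the pair.
  have := hM.delta_comprehension
    (R := fun y i => ∃ σ, σ < y ∧ ∃ τ, τ < y ∧ (σ ∈ S ∧ τ ∈ S ∧ IsNarrow (i + 1) σ τ) ∧ D σ τ i)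
    (Q := fun y i => ∀ σ, σ < y → ∀ τ, τ < y → (σ ∈ S ∧ τ ∈ S ∧ IsNarrow (i + 1) σ τ) → D σ τ i)
    ?_ ?_ ?_
  · convert this using 1
    ext i
    constructor
    · intro hi
      obtain ⟨y, σ, hσy, τ, hτy, hσ, hτ, hn⟩ := hpair i
      exact ⟨y, σ, hσy, τ, hτy, ⟨hσ, hτ, hn⟩, (h i σ hσ τ hτ hn).2 hi⟩
    · rintro ⟨y, σ, hσy, τ, hτy, ⟨hσ, hτ, hn⟩, hi⟩
      exact (h i σ hσ τ hτ hn).1 hi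
  · intro i j
    unfold IsNarrow
    apply_rules [BoundedDef.not, BoundedDef.and, BoundedDef.exLt, BoundedDef.allLt, PolyFun.var,
      PolyFun.const, PolyFun.add]
  · intro i j
    unfold IsNarrow
    apply_rules [BoundedDef.not, BoundedDef.and, BoundedDef.imp, BoundedDef.allLt, PolyFun.var,
      PolyFun.const, PolyFun.add]
  · intro i
    constructor
    · rintro ⟨y, σ, -, τ, -, ⟨hσ, hτ, hn⟩, hi⟩ _ σ' - τ' - ⟨hσ', hτ', hn'⟩
      exact (h i σ' hσ' τ' hτ' hn').2 ((h i σ hσ τ hτ hn).1 hi)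
    · intro hall
      obtain ⟨y, σ, hσy, τ, hτy, hσ, hτ, hn⟩ := hpair i
      exact ⟨y, σ, hσy, τ, hτy, ⟨hσ, hτ, hn⟩, hall y σ hσy τ hτy ⟨hσ, hτ, hn⟩⟩

/-- Colors 3 and 1 always occur on `S`, so 2 or 0 is missing; either way one endpoint of each narrow
interval decides the set. -/
theorem ModelsDT2.sigma_comprehension (hM : ModelsRCA0 𝒮) (hDT : ModelsDT2 𝒮 4 3)
    (hR : BoundedRel 𝒮 R) : {x | ∃ y, R y x} ∈ 𝒮 := by
  obtain ⟨S, hS, hd, c, hc⟩ := hDT _ (hM.colorGraphN_mem hR) (isColoringN_colorGraphN R)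
  simp only [mem_colorGraphN] at hc
  obtain ⟨⟨p₁, hp₁, q₁, hq₁, hpq₁, hlt₁, ha₁⟩, p₂, hp₂, q₂, hq₂, hpq₂, hlt₂, ha₂⟩ :=
    hM.exists_stagesAgree hR hS hd
  obtain ⟨i₃, h₃⟩ := hc p₁ hp₁ q₁ hq₁ hpq₁ 3 (.inl ⟨hlt₁, ha₁, rfl⟩)
  obtain ⟨i₁, h₁⟩ := hc p₂ hp₂ q₂ hq₂ hpq₂ 1 (.inr (.inr (.inl ⟨hlt₂, ha₂, rfl⟩)))
  obtain hA | hA : (∀ p ∈ S, ∀ q ∈ S, ratLtN p q → p < q → StagesAgree R p q) ∨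
      (∀ p ∈ S, ∀ q ∈ S, ratLtN p q → ¬ p < q → StagesAgree R p q) := by
    by_contra! hcon
    obtain ⟨⟨p, hp, q, hq, hpq, hlt, ha⟩, p', hp', q', hq', hpq', hlt', ha'⟩ := hcon
    obtain ⟨i₂, h₂⟩ := hc p hp q hq hpq 2 (.inr (.inl ⟨hlt, ha, rfl⟩))
    obtain ⟨i₀, h₀⟩ := hc p' hp' q' hq' hpq' 0 (.inr (.inr (.inr ⟨not_lt.2 hlt', ha', rfl⟩)))
    -- Four distinct numerals cannot all be among the three values of `c`.
    let g : Fin 4 → Fin 3 := ![i₀, i₁, i₂, i₃]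
    have hg : ∀ k : Fin 4, ((k : ℕ) : N) = c (g k) := by
      intro k
      fin_cases k
      · simpa [g] using h₀
      · simpa [g] using h₁
      · simpa [g] using h₂
      · simpa [g] using h₃
    have hinj : Function.Injective g := fun a b hab => by
      have := (hg a).trans ((congrArg c hab).trans (hg b).symm)
      exact Fin.ext (Nat.cast_injective this)
    have := Fintype.card_le_of_injective g hinj
    simp at this
  · refine hM.mem_of_isNarrow hS hd (D := fun σ _ i => StageN R σ i) (fun i _ k => hR.stageN i k) ?_
    exact (hM.stageN_iff_of_isNarrow hS hd).1 hA
  · refine hM.mem_of_isNarrow hS hd (D := fun _ τ i => StageN R τ i) (fun _ j k => hR.stageN j k) ?_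
    exact (hM.stageN_iff_of_isNarrow hS hd).2 hA

end RationalsOfModel

/-! ### Formulas depend on finitely many variables -/

section FiniteSupport

variable {N : Type u} [CommSemiring N] [LinearOrder N]

theorem NumTerm.exists_support (t : NumTerm) :
    ∃ k : ℕ, ∀ v v' : ℕ → N, (∀ i < k, v i = v' i) → t.eval v = t.eval v' := by
  induction t with
  | var n => exact ⟨n + 1, fun v v' h => h n n.lt_succ_self⟩
  | zero | one => exact ⟨0, fun _ _ _ => rfl⟩
  | add s t ihs iht | mul s t ihs iht =>
    obtain ⟨k, hk⟩ := ihs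
    obtain ⟨l, hl⟩ := iht
    refine ⟨max k l, fun v v' h => ?_⟩
    simp only [NumTerm.eval, hk v v' fun i hi => h i (lt_max_of_lt_left hi),
      hl v v' fun i hi => h i (lt_max_of_lt_right hi)]

theorem consVal_congr {k : ℕ} {v v' : ℕ → N} (h : ∀ i < k, v i = v' i) (x : N) :
    ∀ i < k, consVal x v i = consVal x v' i
  | 0, _ => rfl
  | i + 1, hi => h i (Nat.lt_of_succ_lt hi)

theorem ArithFormula.exists_support (φ : ArithFormula) : ∃ k : ℕ, ∀ (V : ℕ → Set N) (v v' : ℕ → N),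
    (∀ i < k, v i = v' i) → (φ.Holds V v ↔ φ.Holds V v') := by
  induction φ with
  | eq s t | lt s t =>
    obtain ⟨k, hk⟩ := s.exists_support (N := N)
    obtain ⟨l, hl⟩ := t.exists_support (N := N)
    refine ⟨max k l, fun V v v' h => ?_⟩
    simp only [Holds, hk v v' fun i hi => h i (lt_max_of_lt_left hi),
      hl v v' fun i hi => h i (lt_max_of_lt_right hi)]
  | mem t X =>
    obtain ⟨k, hk⟩ := t.exists_support (N := N)
    exact ⟨k, fun V v v' h => by simp only [Holds, hk v v' h]⟩
  | not φ ih =>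
    obtain ⟨k, hk⟩ := ih
    exact ⟨k, fun V v v' h => not_congr (hk V v v' h)⟩
  | and φ ψ ih ih' | or φ ψ ih ih' =>
    obtain ⟨k, hk⟩ := ih
    obtain ⟨l, hl⟩ := ih'
    refine ⟨max k l, fun V v v' h => ?_⟩
    simp only [Holds, hk V v v' fun i hi => h i (lt_max_of_lt_left hi),
      hl V v v' fun i hi => h i (lt_max_of_lt_right hi)]
  | allLt t φ ih | exLt t φ ih =>
    obtain ⟨k, hk⟩ := ih
    obtain ⟨l, hl⟩ := t.exists_support (N := N)
    refine ⟨max k l, fun V v v' h => ?_⟩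
    have := fun x => hk V _ _ (consVal_congr (fun i hi => h i (lt_max_of_lt_left hi)) x)
    simp only [Holds, this, hl v v' fun i hi => h i (lt_max_of_lt_right hi)]
  | all φ ih | ex φ ih =>
    obtain ⟨k, hk⟩ := ih
    refine ⟨k, fun V v v' h => ?_⟩
    have := fun x => hk V _ _ (consVal_congr h x)
    simp only [Holds, this]

end FiniteSupport

/-! ### From `Σ⁰₁` to arithmetical comprehension -/

section Arithmetical

variable {N : Type u} [CommSemiring N] [LinearOrder N]

open Classical in
/-- The components of a pair; both are `0` if `z` does not code a pair. -/
noncomputable def unpairN (z : N) : N × N :=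
  if h : ∃ p : N × N, z = pairN p.1 p.2 then h.choose else 0

/-- The infinite sequence, ultimately `0`, coded by `z`. -/
noncomputable def seqN (z : N) : ℕ → N
  | 0 => (unpairN z).1
  | i + 1 => seqN (unpairN z).2 i

variable [PAMinus N]

theorem unpairN_pairN (a b : N) : unpairN (pairN a b) = (a, b) := by
  have h : ∃ p : N × N, pairN a b = pairN p.1 p.2 := ⟨(a, b), rfl⟩
  rw [unpairN, dif_pos h]
  obtain ⟨h1, h2⟩ := pairN_injective h.choose_spec
  exact Prod.ext h1.symm h2.symm

theorem seqN_pairN (x z : N) : seqN (pairN x z) = consVal x (seqN z) := by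
  funext i
  cases i <;> simp only [seqN, unpairN_pairN, consVal]

theorem exists_seqN_eq (k : ℕ) (v : ℕ → N) : ∃ z : N, ∀ i < k, seqN z i = v i := by
  induction k generalizing v with
  | zero => exact ⟨0, fun i hi => absurd hi i.not_lt_zero⟩
  | succ k ih =>
    obtain ⟨z, hz⟩ := ih fun i => v (i + 1)
    refine ⟨pairN (v 0) z, fun i hi => ?_⟩
    rw [seqN_pairN]
    cases i with
    | zero => rfl
    | succ i => exact hz i (Nat.lt_of_succ_lt_succ hi)

theorem unpairN_eq_iff {z a b : N} : unpairN z = (a, b) ↔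
    z = pairN a b ∨ ((∀ a', a' < z + 1 → ∀ b', b' < z + 1 → ¬ z = pairN a' b') ∧ a = 0 ∧ b = 0) := by
  by_cases h : ∃ p : N × N, z = pairN p.1 p.2
  · obtain ⟨⟨x, y⟩, rfl⟩ := h
    rw [unpairN_pairN]
    constructor
    · rintro ⟨⟩
      exact .inl rfl
    · rintro (h | ⟨h, -⟩)
      · exact Prod.ext (pairN_injective h).1 (pairN_injective h).2
      · exact absurd rfl (h x (PAMinus.lt_add_one_iff.2 (le_pairN_left x y)) y
          (PAMinus.lt_add_one_iff.2 (le_pairN_right x y)))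
  · rw [unpairN, dif_neg h]
    constructor
    · rintro ⟨⟩
      exact .inr ⟨fun a' _ b' _ h' => h ⟨(a', b'), h'⟩, rfl, rfl⟩
    · rintro (h' | ⟨-, rfl, rfl⟩)
      · exact absurd ⟨(a, b), h'⟩ h
      · rfl

variable {𝒮 : Set (Set N)}

theorem BoundedDef.unpairN (hne : 𝒮.Nonempty) (i j k : ℕ) :
    BoundedDef 𝒮 (fun v : ℕ → N => unpairN (v i) = (v j, v k)) := by
  refine BoundedDef.congr ?_ fun v => unpairN_eq_iff
  apply_rules [BoundedDef.not, BoundedDef.and, BoundedDef.or, BoundedDef.allLt, BoundedDef.eq,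
    PolyFun.var, PolyFun.const, PolyFun.pairN, PolyFun.add]

/-- The graph of the function given by a term, as a set of pairs. -/
def termGraph (t : NumTerm) : Set N := {y | ∃ z, y = pairN z (t.eval (seqN z))}

theorem mem_termGraph {t : NumTerm} {z u : N} :
    pairN z u ∈ termGraph t ↔ u = t.eval (seqN z) := by
  constructor
  · rintro ⟨z', h⟩
    obtain ⟨rfl, h⟩ := pairN_injective h
    exact h
  · rintro rfl
    exact ⟨z, rfl⟩

/-- Sets of pairs may be given by `Σ⁰₁` conditions on the components. -/
theorem pairSet_mem (hsig : ∀ R : N → N → Prop, BoundedRel 𝒮 R → {x | ∃ y, R y x} ∈ 𝒮)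
    (hne : 𝒮.Nonempty) {R : N → N → N → Prop}
    (hR : ∀ i j k, BoundedDef 𝒮 (fun v => R (v i) (v j) (v k))) {A : Set N}
    (hA : ∀ y, y ∈ A ↔ ∃ z u, y = pairN z u ∧ ∃ w, R w z u) : A ∈ 𝒮 := by
  convert hsig (fun w y => ∃ z, z < y + 1 ∧ ∃ u, u < y + 1 ∧ y = pairN z u ∧ R w z u) ?_ using 1
  · ext y
    rw [hA]
    constructor
    · rintro ⟨z, u, rfl, w, h⟩
      exact ⟨w, z, PAMinus.lt_add_one_iff.2 (le_pairN_left z u), u,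
        PAMinus.lt_add_one_iff.2 (le_pairN_right z u), rfl, h⟩
    · rintro ⟨w, z, -, u, -, h, h'⟩
      exact ⟨z, u, h, w, h'⟩
  · intro i j
    apply_rules [BoundedDef.and, BoundedDef.exLt, BoundedDef.eq, PolyFun.var, PolyFun.const,
      PolyFun.pairN, PolyFun.add]

/-- One application of `Σ⁰₁` comprehension per step of the recursion on the term, with the graphs
already obtained as set parameters; a variable is reached by peeling off pairs one at a time. -/
theorem termGraph_mem (hsig : ∀ R : N → N → Prop, BoundedRel 𝒮 R → {x | ∃ y, R y x} ∈ 𝒮)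
    (hne : 𝒮.Nonempty) (t : NumTerm) : termGraph t ∈ 𝒮 := by
  have hy : ∀ (t : NumTerm) (y : N), y ∈ termGraph t ↔ ∃ z u, y = pairN z u ∧ u = t.eval (seqN z) :=
    fun t y => ⟨fun ⟨z, h⟩ => ⟨z, _, h, rfl⟩, fun ⟨z, u, h, h'⟩ => ⟨z, h' ▸ h⟩⟩
  induction t with
  | var n =>
    induction n with
    | zero =>
      refine pairSet_mem hsig hne (R := fun w z u => unpairN z = (u, w))
        (fun i j k => .unpairN hne j k i) fun y => ?_
      simp only [hy, NumTerm.eval, seqN, Prod.ext_iff]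
      refine exists_congr fun z => exists_congr fun u => and_congr_right fun _ => ?_
      exact ⟨fun h => ⟨_, h.symm, rfl⟩, fun ⟨_, h, _⟩ => h.symm⟩
    | succ n ih =>
      -- The unbounded witness `w` serves only as a common bound for the intermediate values.
      refine pairSet_mem hsig hne (R := fun w z u => ∃ b, b < w ∧ ∃ a, a < w ∧ unpairN z = (a, b) ∧
        pairN b u ∈ termGraph (.var n)) (fun i j k => ?_) fun y => ?_
      · exact .exLt (.var _) (.exLt (.var _) (.and (.unpairN hne _ _ _)
          (.mem ih (.pairN (.var _) (.var _)))))
      · rw [hy]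
        simp only [mem_termGraph, NumTerm.eval, seqN]
        refine exists_congr fun z => exists_congr fun u => and_congr_right fun _ => ?_
        constructor
        · intro h
          exact ⟨(unpairN z).1 + (unpairN z).2 + 1, _, PAMinus.lt_add_one_iff.2 le_add_self, _,
            PAMinus.lt_add_one_iff.2 le_self_add, rfl, h⟩
        · rintro ⟨w, b, -, a, -, h1, h2⟩
          rw [h1]
          exact h2
  | zero =>
    refine pairSet_mem hsig hne (R := fun _ _ u => u = 0) (fun _ _ k => .eq hne (.var k) (.const 0))
      fun y => ?_
    simp only [hy, NumTerm.eval, exists_const]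
  | one =>
    refine pairSet_mem hsig hne (R := fun _ _ u => u = 1) (fun _ _ k => .eq hne (.var k) (.const 1))
      fun y => ?_
    simp only [hy, NumTerm.eval, exists_const]
  | add s t ihs iht =>
    refine pairSet_mem hsig hne (R := fun w z u => ∃ a, a < w ∧ ∃ b, b < w ∧ pairN z a ∈ termGraph s ∧
      pairN z b ∈ termGraph t ∧ u = a + b) (fun i j k => ?_) fun y => ?_
    · exact .exLt (.var _) (.exLt (.var _) (.and (.mem ihs (.pairN (.var _) (.var _)))
        (.and (.mem iht (.pairN (.var _) (.var _))) (.eq hne (.var _) (.add (.var _) (.var _))))))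
    · rw [hy]
      simp only [mem_termGraph, NumTerm.eval]
      refine exists_congr fun z => exists_congr fun u => and_congr_right fun _ => ?_
      constructor
      · intro h
        exact ⟨s.eval (seqN z) + t.eval (seqN z) + 1, _, PAMinus.lt_add_one_iff.2 le_self_add, _,
          PAMinus.lt_add_one_iff.2 le_add_self, rfl, rfl, h⟩
      · rintro ⟨w, a, -, b, -, rfl, rfl, h⟩
        exact h
  | mul s t ihs iht =>
    refine pairSet_mem hsig hne (R := fun w z u => ∃ a, a < w ∧ ∃ b, b < w ∧ pairN z a ∈ termGraph s ∧
      pairN z b ∈ termGraph t ∧ u = a * b) (fun i j k => ?_) fun y => ?_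
    · exact .exLt (.var _) (.exLt (.var _) (.and (.mem ihs (.pairN (.var _) (.var _)))
        (.and (.mem iht (.pairN (.var _) (.var _))) (.eq hne (.var _) (.mul (.var _) (.var _))))))
    · rw [hy]
      simp only [mem_termGraph, NumTerm.eval]
      refine exists_congr fun z => exists_congr fun u => and_congr_right fun _ => ?_
      constructor
      · intro h
        exact ⟨s.eval (seqN z) + t.eval (seqN z) + 1, _, PAMinus.lt_add_one_iff.2 le_self_add, _,
          PAMinus.lt_add_one_iff.2 le_add_self, rfl, rfl, h⟩
      · rintro ⟨w, a, -, b, -, rfl, rfl, h⟩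
        exact h

/-- Evaluating a term on the sequence coded by `z`, in a condition on `z`. -/
theorem termCondition_mem (hsig : ∀ R : N → N → Prop, BoundedRel 𝒮 R → {x | ∃ y, R y x} ∈ 𝒮)
    (hne : 𝒮.Nonempty) (t : NumTerm) {P : N → N → Prop} (hP : BoundedRel 𝒮 P) :
    {z | P (t.eval (seqN z)) z} ∈ 𝒮 := by
  convert hsig (fun u z => pairN z u ∈ termGraph t ∧ P u z) ?_ using 1
  · ext z
    simp [mem_termGraph]
  · exact fun i j => .and (.mem (termGraph_mem hsig hne t) (.pairN (.var _) (.var _))) (hP i j)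

/-- Induction on the formula: by `seqN_pairN`, binding a variable amounts to pairing its value onto
the code `z`. Each unbounded quantifier costs one `Σ⁰₁` comprehension relative to the set obtained
for its scope. -/
theorem holds_seqN_mem (hM : ModelsRCA0 𝒮)
    (hsig : ∀ R : N → N → Prop, BoundedRel 𝒮 R → {x | ∃ y, R y x} ∈ 𝒮) {V : ℕ → Set N}
    (hV : ∀ i, V i ∈ 𝒮) (φ : ArithFormula) : {z | φ.Holds V (seqN z)} ∈ 𝒮 := by
  have hne := hM.nonempty
  have hcompl : ∀ {A : Set N}, A ∈ 𝒮 → Aᶜ ∈ 𝒮 := fun hA =>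
    hM.bounded_comprehension fun i => (BoundedDef.mem hA (.var i)).not
  have hexLt : ∀ (t : NumTerm) {A : Set N}, A ∈ 𝒮 →
      {z | ∃ x, x < t.eval (seqN z) ∧ pairN x z ∈ A} ∈ 𝒮 := fun t A hA =>
    termCondition_mem hsig hne t (P := fun u z => ∃ x, x < u ∧ pairN x z ∈ A) fun _ _ =>
      .exLt (.var _) (.mem hA (.pairN (.var _) (.var _)))
  have hex : ∀ {A : Set N}, A ∈ 𝒮 → {z | ∃ x, pairN x z ∈ A} ∈ 𝒮 := fun hA =>
    hsig (fun x z => pairN x z ∈ _) fun _ _ => .mem hA (.pairN (.var _) (.var _))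
  induction φ with
  | eq s t =>
    exact termCondition_mem hsig hne s (P := fun u z => u = t.eval (seqN z)) fun i j =>
      BoundedDef.congr (.mem (termGraph_mem hsig hne t) (.pairN (.var j) (.var i)))
        fun v => mem_termGraph.symm
  | lt s t =>
    refine termCondition_mem hsig hne s (P := fun u z => u < t.eval (seqN z)) fun i j => ?_
    refine BoundedDef.congr (.mem (A := {y | ∃ u z, y = pairN u z ∧ u < t.eval (seqN z)}) ?_
      (.pairN (.var i) (.var j))) fun v => ?_
    · refine pairSet_mem hsig hne (R := fun w u z => pairN z w ∈ termGraph t ∧ u < w)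
        (fun i j k => .and (.mem (termGraph_mem hsig hne t) (.pairN (.var k) (.var i)))
          (.lt hne (.var j) (.var i))) fun y => ?_
      simp [mem_termGraph]
    · constructor
      · exact fun h => ⟨_, _, rfl, h⟩
      · rintro ⟨u, z, h, h'⟩
        obtain ⟨rfl, rfl⟩ := pairN_injective h
        exact h'
  | mem t X =>
    exact termCondition_mem hsig hne t (P := fun u _ => u ∈ V X) fun i _ => .mem (hV X) (.var i)
  | not φ ih => exact hcompl ih
  | and φ ψ ih ih' =>
    exact hM.bounded_comprehension fun i => (BoundedDef.mem ih (.var i)).and (.mem ih' (.var i))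
  | or φ ψ ih ih' =>
    exact hM.bounded_comprehension fun i => (BoundedDef.mem ih (.var i)).or (.mem ih' (.var i))
  | allLt t φ ih =>
    convert hcompl (hexLt t (hcompl ih)) using 1
    ext z
    simp [ArithFormula.Holds, seqN_pairN]
  | exLt t φ ih =>
    convert hexLt t ih using 1
    ext z
    simp [ArithFormula.Holds, seqN_pairN]
  | all φ ih =>
    convert hcompl (hex (hcompl ih)) using 1
    ext z
    simp [ArithFormula.Holds, seqN_pairN]
  | ex φ ih =>
    convert hex ih using 1
    ext z
    simp [ArithFormula.Holds, seqN_pairN]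

/-- `Σ⁰₁` comprehension implies arithmetical comprehension. -/
theorem ModelsACA0.of_sigma_comprehension (hM : ModelsRCA0 𝒮)
    (hsig : ∀ R : N → N → Prop, BoundedRel 𝒮 R → {x | ∃ y, R y x} ∈ 𝒮) : ModelsACA0 𝒮 := by
  refine ⟨hM, fun φ V v hV => ?_⟩
  -- Only finitely many entries of `v` matter, so one element `z` of the model codes all number
  -- parameters.
  obtain ⟨k, hk⟩ := φ.exists_support (N := N)
  obtain ⟨z, hz⟩ := exists_seqN_eq k v
  convert hM.bounded_comprehension (P := fun x => pairN x z ∈ {z | φ.Holds V (seqN z)}) ?_ using 1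
  · ext x
    simp only [Set.mem_ofPred_eq, seqN_pairN]
    exact (hk V _ _ (consVal_congr hz x)).symm
  · exact fun i => .mem (holds_seqN_mem hM hsig hV φ) (.pairN (.var i) (.const z))

end Arithmetical

theorem ModelsDT2.modelsACA0 {N : Type u} [CommSemiring N] [LinearOrder N] {𝒮 : Set (Set N)}
    (hM : ModelsRCA0 𝒮) (hDT : ModelsDT2 𝒮 4 3) : ModelsACA0 𝒮 :=
  haveI := hM.paMinus
  .of_sigma_comprehension hM fun _ hR => hDT.sigma_comprehension hM hR

/-! ## Binary strings -/

section Strings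

@[simp] theorem not_ltQ_nil_nil : ¬ ltQ [] [] := by simp [ltQ]

@[simp] theorem ltQ_nil_cons {b : Bool} {τ : List Bool} : ltQ [] (b :: τ) ↔ b = true := by
  simp [ltQ]

@[simp] theorem ltQ_cons_nil {a : Bool} {σ : List Bool} : ltQ (a :: σ) [] ↔ a = false := by
  simp [ltQ]

@[simp] theorem ltQ_cons_cons {a b : Bool} {σ τ : List Bool} :
    ltQ (a :: σ) (b :: τ) ↔ (a = false ∧ b = true) ∨ (a = b ∧ ltQ σ τ) := by
  by_cases h : a = b
  · subst h
    simp only [ltQ, List.cons_prefix_cons, true_and, List.length_cons, List.getElem?_cons_succ,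
      List.cons_lt_cons_iff, lt_self_iff_false, false_or]
    simp
  · have h' : ¬ b = a := fun e => h e.symm
    simp only [ltQ, List.cons_prefix_cons, h, h', false_and, not_false_eq_true, true_and, false_or,
      List.cons_lt_cons_iff, Bool.lt_iff, or_false]

theorem meet_length_le_right (σ τ : List Bool) : (meet σ τ).length ≤ τ.length := by
  induction σ generalizing τ with
  | nil => simp [meet]
  | cons a σ ih =>
    cases τ with
    | nil => simp [meet]
    | cons b τ =>
      simp only [meet]
      split_ifs
      · simpa using ih τ
      · simp

theorem le_meet_length_iff {σ τ : List Bool} {k : ℕ} :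
    k ≤ (meet σ τ).length ↔ k ≤ σ.length ∧ k ≤ τ.length ∧ σ.take k = τ.take k := by
  induction σ generalizing τ k with
  | nil => cases k <;> simp [meet]
  | cons a σ ih =>
    cases τ with
    | nil => cases k <;> simp [meet]
    | cons b τ =>
      cases k with
      | zero => simp
      | succ k =>
        simp only [meet]
        split_ifs with h
        · simp [ih, h]
        · simp [h]

/-- The extensions of a fixed string are convex for `ltQ`, so `ρ` extends the meet of `σ` and `τ`.
-/
theorem meet_length_le_of_between {σ ρ τ : List Bool} (h : ltQ σ ρ) (h' : ltQ ρ τ) :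
    (meet σ τ).length ≤ (meet σ ρ).length ∧ (meet σ τ).length ≤ (meet ρ τ).length := by
  induction σ generalizing ρ τ with
  | nil => simp [meet]
  | cons a σ ih =>
    cases τ with
    | nil => simp [meet]
    | cons b τ =>
      by_cases hab : a = b
      · subst hab
        cases ρ with
        | nil =>
          simp only [ltQ_cons_nil, ltQ_nil_cons] at h h'
          simp [h] at h'
        | cons c ρ =>
          simp only [ltQ_cons_cons] at h h'
          have hac : a = c := by
            rcases h with ⟨h1, h2⟩ | ⟨h1, -⟩
            · rcases h' with ⟨h3, -⟩ | ⟨h3, -⟩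
              · simp [h2] at h3
              · exact h3.symm
            · exact h1
          subst hac
          simp only [true_and] at h h'
          have h1 : ltQ σ ρ := by rcases h with ⟨h, h2⟩ | h <;> simp_all
          have h2 : ltQ ρ τ := by rcases h' with ⟨h, h2⟩ | h <;> simp_all
          simpa [meet] using ih h1 h2
      · simp [meet, hab]

/-- The order is decided just after the meet, where the end of a string ranks between `false` and
`true`. This form makes `ltQ` visibly computable. -/
theorem ltQ_iff_getElem? {σ τ : List Bool} :
    ltQ σ τ ↔ σ[(meet σ τ).length]? = some false ∨
      (σ[(meet σ τ).length]? = none ∧ τ[(meet σ τ).length]? = some true) := by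
  induction σ generalizing τ with
  | nil =>
    cases τ <;> simp [meet]
  | cons a σ ih =>
    cases τ with
    | nil => simp [meet]
    | cons b τ =>
      by_cases hab : a = b
      · subst hab
        have : ¬ (a = false ∧ a = true) := by rintro ⟨h1, h2⟩; simp [h1] at h2
        simp only [ltQ_cons_cons, this, false_or, true_and, meet, if_true, List.length_cons,
          List.getElem?_cons_succ, ih]
      · simp only [ltQ_cons_cons, hab, false_and, or_false, meet, if_false, List.length_nil]
        revert hab
        cases a <;> cases b <;> simp

end Strings

/-! ## Solutions of the product coloring -/

section ProductColoring

variable {e : ℚ ≃ List Bool} {A : ℕ → Set ℕ} {K : Set ℕ} {S : Set ℚ}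

/-- An interval of `S` is infinite, while only finitely many strings have length at most `n`. -/
theorem exists_between_length_lt (hS : DenselyOrdered S) (e : ℚ ≃ List Bool) {p q : ℚ} (hp : p ∈ S)
    (hq : q ∈ S) (hpq : p < q) (n : ℕ) : ∃ r ∈ S, p < r ∧ r < q ∧ n < (e r).length := by
  have hinf : (Set.Ioo (⟨p, hp⟩ : S) ⟨q, hq⟩).Infinite := Set.Ioo_infinite hpq
  by_contra! hcon
  refine hinf ?_
  refine Set.Finite.of_finite_image (f := fun r : S => e r)
    ((List.finite_length_le Bool n).subset ?_) fun a _ b _ hab => Subtype.ext (e.injective hab)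
  rintro _ ⟨⟨r, hr⟩, ⟨h1, h2⟩, rfl⟩
  exact hcon r hr h1 h2

theorem exists_lt_length_lt (hS : DenselyOrdered S) (hS' : NoMinOrder S) (e : ℚ ≃ List Bool) {q : ℚ}
    (hq : q ∈ S) (n : ℕ) : ∃ p ∈ S, p < q ∧ n < (e p).length := by
  obtain ⟨⟨p, hp⟩, hpq⟩ := hS'.exists_lt ⟨q, hq⟩
  obtain ⟨r, hr, -, h1, h2⟩ := exists_between_length_lt hS e hp hq hpq n
  exact ⟨r, hr, h1, h2⟩

theorem exists_gt_length_lt (hS : DenselyOrdered S) (hS' : NoMaxOrder S) (e : ℚ ≃ List Bool) {p : ℚ}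
    (hp : p ∈ S) (n : ℕ) : ∃ q ∈ S, p < q ∧ n < (e q).length := by
  obtain ⟨⟨q, hq⟩, hpq⟩ := hS'.exists_gt ⟨p, hp⟩
  obtain ⟨r, hr, h1, -, h2⟩ := exists_between_length_lt hS e hp hq hpq n
  exact ⟨r, hr, h1, h2⟩

/-- Two members of a dense suborder have a long common initial segment. -/
theorem exists_lt_meet_length (hS : DenselyOrdered S) (hS' : NoMaxOrder S) (hne : S.Nonempty)
    (e : ℚ ≃ List Bool) (n : ℕ) : ∃ p ∈ S, ∃ q ∈ S, p < q ∧ n < (meet (e p) (e q)).length := by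
  have hinf : {p | p ∈ S ∧ n < (e p).length}.Infinite := by
    obtain ⟨p, hp⟩ := hne
    intro hfin
    obtain ⟨m, hm⟩ := (hfin.image fun p => (e p).length).bddAbove
    obtain ⟨q, hq, -, hq'⟩ := exists_gt_length_lt hS hS' e hp (max n m)
    have := hm ⟨q, ⟨hq, (le_max_left n m).trans_lt hq'⟩, rfl⟩
    exact absurd ((le_max_right n m).trans_lt hq') (not_lt.2 this)
  have hmaps : Set.MapsTo (fun p => (e p).take (n + 1)) {p | p ∈ S ∧ n < (e p).length}
      {l : List Bool | l.length ≤ n + 1} := fun p _ => by simp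
  -- Pigeonhole: infinitely many members of `S` have only finitely many truncations to length `n +
  -- 1`.
  obtain ⟨p, hp, q, hq, hpq, h⟩ :=
    hinf.exists_ne_map_eq_of_mapsTo hmaps (List.finite_length_le Bool (n + 1))
  rcases lt_or_gt_of_ne hpq with hlt | hlt
  · exact ⟨p, hp.1, q, hq.1, hlt, le_meet_length_iff.2 ⟨hp.2, hq.2, h⟩⟩
  · exact ⟨q, hq.1, p, hp.1, hlt, le_meet_length_iff.2 ⟨hq.2, hp.2, h.symm⟩⟩

theorem exists_stage (hA : Monotone A) (hK : ⋃ s, A s = K) (n : ℕ) :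
    ∃ s, ∀ i < n, i ∈ K → i ∈ A s := by
  induction n with
  | zero => exact ⟨0, fun i hi => absurd hi i.not_lt_zero⟩
  | succ n ih =>
    obtain ⟨s, hs⟩ := ih
    by_cases hn : n ∈ K
    · obtain ⟨t, ht⟩ := Set.mem_iUnion.1 (hK ▸ hn)
      refine ⟨max s t, fun i hi hiK => ?_⟩
      rcases Nat.lt_succ_iff_lt_or_eq.1 hi with h | rfl
      · exact hA (le_max_left s t) (hs i h hiK)
      · exact hA (le_max_right s t) ht
    · refine ⟨s, fun i hi hiK => ?_⟩
      rcases Nat.lt_succ_iff_lt_or_eq.1 hi with h | rfl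
      · exact hs i h hiK
      · exact absurd hiK hn

theorem productColoring_of_ltQ {σ τ : List Bool} (h : ltQ σ τ) [Decidable (σ.length < τ.length)]
    [Decidable (JockuschOne A (meet σ τ).length σ.length τ.length)] :
    productColoring A σ τ = (if σ.length < τ.length then 2 else 0) +
      (if JockuschOne A (meet σ τ).length σ.length τ.length then 1 else 0) := by
  unfold productColoring EmbeddingTypeOne
  simp only [h, iff_true]
  congr

/-- The Jockusch color is `1` for all pairs from `S` of one embedding type. -/
theorem IsDevlinSolution.forall_jockuschOne (he : ∀ p q : ℚ, p < q ↔ ltQ (e p) (e q))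
    (hA : Monotone A) (hK : ⋃ s, A s = K)
    (hS : IsDevlinSolution 3 (fun p q => productColoring A (e p) (e q)) S) :
    (∀ p ∈ S, ∀ q ∈ S, p < q → (e p).length < (e q).length →
      JockuschOne A (meet (e p) (e q)).length (e p).length (e q).length) ∨
    (∀ p ∈ S, ∀ q ∈ S, p < q → ¬ (e p).length < (e q).length →
      JockuschOne A (meet (e p) (e q)).length (e p).length (e q).length) := by
  classical
  obtain ⟨⟨ρ, hρ⟩, hd, hmin, hmax, hcard⟩ := hS
  obtain ⟨s, hs⟩ := exists_stage hA hK (e ρ).length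
  have key : ∀ p q, p < ρ → ρ < q → s < (e p).length → s < (e q).length →
      JockuschOne A (meet (e p) (e q)).length (e p).length (e q).length := by
    intro p q hp hq hsp hsq i hi
    have hi' : i < (e ρ).length := (hi.trans_le
      (meet_length_le_of_between ((he _ _).1 hp) ((he _ _).1 hq)).1).trans_le
        (meet_length_le_right _ _)
    have hmem : ∀ t, s < t → (i ∈ A t ↔ i ∈ K) := fun t ht =>
      ⟨fun h => hK ▸ Set.mem_iUnion.2 ⟨t, h⟩, fun h => hA ht.le (hs i hi' h)⟩
    rw [hmem _ hsp, hmem _ hsq]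
  by_contra! hcon
  obtain ⟨⟨p₂, hp₂, q₂, hq₂, h₂, hl₂, hJ₂⟩, p₀, hp₀, q₀, hq₀, h₀, hl₀, hJ₀⟩ := hcon
  obtain ⟨p₃, hp₃, hpρ₃, hs₃⟩ := exists_lt_length_lt hd hmin e hρ s
  obtain ⟨q₃, hq₃, hρq₃, hl₃⟩ := exists_gt_length_lt hd hmax e hρ (e p₃).length
  obtain ⟨q₁, hq₁, hρq₁, hs₁⟩ := exists_gt_length_lt hd hmax e hρ s
  obtain ⟨p₁, hp₁, hpρ₁, hl₁⟩ := exists_lt_length_lt hd hmin e hρ (e q₁).length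
  have huniv : colorsUsed (fun p q => productColoring A (e p) (e q)) S = Set.univ := by
    refine Set.eq_univ_of_forall fun c => ?_
    have hval : ∀ p q, p < q → productColoring A (e p) (e q) = _ := fun p q hpq =>
      productColoring_of_ltQ ((he p q).1 hpq)
    fin_cases c
    · refine ⟨p₀, hp₀, q₀, hq₀, h₀, (hval _ _ h₀).trans ?_⟩
      rw [if_neg (not_lt.2 hl₀), if_neg hJ₀]
      rfl
    · refine ⟨p₁, hp₁, q₁, hq₁, hpρ₁.trans hρq₁, (hval _ _ (hpρ₁.trans hρq₁)).trans ?_⟩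
      rw [if_neg hl₁.not_gt, if_pos (key _ _ hpρ₁ hρq₁ (hs₁.trans hl₁) hs₁)]
      rfl
    · refine ⟨p₂, hp₂, q₂, hq₂, h₂, (hval _ _ h₂).trans ?_⟩
      rw [if_pos hl₂, if_neg hJ₂]
      rfl
    · refine ⟨p₃, hp₃, q₃, hq₃, hpρ₃.trans hρq₃, (hval _ _ (hpρ₃.trans hρq₃)).trans ?_⟩
      rw [if_pos hl₃, if_pos (key _ _ hpρ₃ hρq₃ hs₃ (hs₃.trans hl₃))]
      rfl
  rw [huniv, Set.ncard_univ, Nat.card_eq_fintype_card, Fintype.card_fin] at hcard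
  omega

/-- One of the two endpoints of an interval with endpoints in `S` gives a stage of the enumeration
which is correct below the length of the meet. -/
theorem IsDevlinSolution.mem_stage_iff (he : ∀ p q : ℚ, p < q ↔ ltQ (e p) (e q))
    (hA : Monotone A) (hK : ⋃ s, A s = K)
    (hS : IsDevlinSolution 3 (fun p q => productColoring A (e p) (e q)) S) :
    (∀ p ∈ S, ∀ q ∈ S, p < q → ∀ i < (meet (e p) (e q)).length, (i ∈ A (e p).length ↔ i ∈ K)) ∨
    (∀ p ∈ S, ∀ q ∈ S, p < q → ∀ i < (meet (e p) (e q)).length, (i ∈ A (e q).length ↔ i ∈ K)) := by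
  have hd := hS.2.1
  refine (hS.forall_jockuschOne he hA hK).imp (fun h p hp q hq hpq i hi => ?_)
    fun h p hp q hq hpq i hi => ?_
  all_goals
    refine ⟨fun hi => hK ▸ Set.mem_iUnion.2 ⟨_, hi⟩, fun hiK => ?_⟩
    obtain ⟨s, hs⟩ := exists_stage hA hK (i + 1)
    have hs' := hs i i.lt_succ_self hiK
  · obtain ⟨r, hr, h1, h2, h3⟩ := exists_between_length_lt hd e hp hq hpq (max s (e p).length)
    have hm := (meet_length_le_of_between ((he _ _).1 h1) ((he _ _).1 h2)).1
    exact (h p hp r hr h1 ((le_max_right _ _).trans_lt h3) i (hi.trans_le hm)).2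
      (hA ((le_max_left _ _).trans h3.le) hs')
  · obtain ⟨r, hr, h1, h2, h3⟩ := exists_between_length_lt hd e hp hq hpq (max s (e q).length)
    have hm := (meet_length_le_of_between ((he _ _).1 h1) ((he _ _).1 h2)).2
    exact (h r hr q hq h2 ((le_max_right _ _).trans_lt h3).not_gt i (hi.trans_le hm)).1
      (hA ((le_max_left _ _).trans h3.le) hs')

end ProductColoring

/-! ## Computability -/

section Search

theorem Nat.RecursiveIn.comp_total {O : Set (ℕ →. ℕ)} {f g : ℕ → ℕ}
    (hf : Nat.RecursiveIn O fun n => Part.some (f n))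
    (hg : Nat.RecursiveIn O fun n => Part.some (g n)) :
    Nat.RecursiveIn O fun n => Part.some (f (g n)) :=
  (Nat.RecursiveIn.comp hf hg).of_eq fun n => by simp

theorem Nat.RecursiveIn.pair_total {O : Set (ℕ →. ℕ)} {f g : ℕ → ℕ}
    (hf : Nat.RecursiveIn O fun n => Part.some (f n))
    (hg : Nat.RecursiveIn O fun n => Part.some (g n)) :
    Nat.RecursiveIn O fun n => Part.some (Nat.pair (f n) (g n)) :=
  (Nat.RecursiveIn.pair hf hg).of_eq fun n => by simp [Seq.seq]

theorem Computable.recursiveIn_nat {O : Set (ℕ →. ℕ)} {f : ℕ → ℕ} (hf : Computable f) :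
    Nat.RecursiveIn O fun n => Part.some (f n) :=
  RecursiveIn.iff_nat.1 hf.computableIn

/-- `A` is reducible to `B` if membership in `A` can be read off from any pair of members of `B` that
passes a computable test, and such a pair always exists. -/
theorem SetTuringReducible.of_search {A B : Set ℕ} {test out : ℕ × ℕ × ℕ → Bool}
    (htest : Computable test) (hout : Computable out)
    (hex : ∀ n, ∃ a ∈ B, ∃ b ∈ B, test (n, a, b) = true)
    (h : ∀ n, ∀ a ∈ B, ∀ b ∈ B, test (n, a, b) = true → (out (n, a, b) = true ↔ n ∈ A)) :
    SetTuringReducible A B := by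
  classical
  let χ : ℕ → ℕ := fun n => if n ∈ B then 1 else 0
  have hcf : charFun B = fun n => Part.some (χ n) := by
    funext n
    simp only [charFun, χ]
  have hχ : Nat.RecursiveIn {charFun B} fun n => Part.some (χ n) := hcf ▸ .oracle _ rfl
  let triple : ℕ → ℕ × ℕ × ℕ := fun k => (k.unpair.1, k.unpair.2.unpair.1, k.unpair.2.unpair.2)
  have hfst : Computable fun k : ℕ => k.unpair.1 := Computable.fst.comp Computable.unpair
  have hsnd : Computable fun k : ℕ => k.unpair.2 := Computable.snd.comp Computable.unpair
  have hleft : Computable fun k : ℕ => k.unpair.2.unpair.1 := hfst.comp hsnd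
  have hright : Computable fun k : ℕ => k.unpair.2.unpair.2 := hsnd.comp hsnd
  have htriple : Computable triple := hfst.pair (hleft.pair hright)
  -- The value is 0 exactly when the test succeeds and both characteristic values are 1, so that
  -- unbounded search for a zero finds a suitable pair from `B`.
  let comb : ℕ → ℕ := fun j => cond (test (triple j.unpair.1))
    (2 - (j.unpair.2.unpair.1 + j.unpair.2.unpair.2)) 1
  have hcomb : Computable comb := by
    refine Computable.cond (htest.comp (htriple.comp hfst)) ?_ (Computable.const 1)
    exact Primrec.nat_sub.to_comp.comp (Computable.const 2)
      (Primrec.nat_add.to_comp.comp hleft hright)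
  let T : ℕ → ℕ := fun k => comb (Nat.pair k (Nat.pair (χ k.unpair.2.unpair.1)
    (χ k.unpair.2.unpair.2)))
  have hT : Nat.RecursiveIn {charFun B} fun k => Part.some (T k) :=
    hcomb.recursiveIn_nat.comp_total (Computable.id.recursiveIn_nat.pair_total
      ((hχ.comp_total hleft.recursiveIn_nat).pair_total (hχ.comp_total hright.recursiveIn_nat)))
  have hT0 : ∀ n m, T (Nat.pair n m) = 0 ↔
      m.unpair.1 ∈ B ∧ m.unpair.2 ∈ B ∧ test (n, m.unpair.1, m.unpair.2) = true := by
    intro n m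
    cases htv : test (n, m.unpair.1, m.unpair.2) <;> by_cases h1 : m.unpair.1 ∈ B <;>
      by_cases h2 : m.unpair.2 ∈ B <;> simp [T, comb, triple, χ, htv, h1, h2]
  have hexT : ∀ n, ∃ m, T (Nat.pair n m) = 0 := by
    intro n
    obtain ⟨a, ha, b, hb, hab⟩ := hex n
    exact ⟨Nat.pair a b, (hT0 n _).2 (by simpa using ⟨ha, hb, hab⟩)⟩
  have hfind : Nat.RecursiveIn {charFun B} fun n => Part.some (Nat.find (hexT n)) := by
    refine (Nat.RecursiveIn.rfind hT).of_eq fun n => Part.eq_some_iff.2 (Nat.mem_rfind.2 ⟨?_, ?_⟩)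
    · simpa using Nat.find_spec (hexT n)
    · intro m hm
      simpa using Nat.find_min (hexT n) hm
  let res : ℕ → ℕ := fun k => cond (out (triple k)) 1 0
  have hres : Computable res :=
    Computable.cond (hout.comp htriple) (Computable.const 1) (Computable.const 0)
  refine RecursiveIn.iff_nat.2 ((hres.recursiveIn_nat.comp_total
    (Computable.id.recursiveIn_nat.pair_total hfind)).of_eq fun n => ?_)
  obtain ⟨h1, h2, h3⟩ := (hT0 n _).1 (Nat.find_spec (hexT n))
  have := h n _ h1 _ h2 h3
  simp only [charFun, res, triple, id, Nat.unpair_pair]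
  congr 1
  by_cases hA : n ∈ A
  · rw [if_pos hA, this.2 hA, cond_true]
  · rw [if_neg hA, Bool.eq_false_of_not_eq_true fun hc => hA (this.1 hc), cond_false]

end Search

/-! ### The halting set and its enumeration -/

section HaltingSet

open Nat.Partrec (Code)

theorem haltingSet_rePred : REPred fun n => n ∈ haltingSet := by
  have : Partrec fun n : ℕ => (Denumerable.ofNat Code n).eval n :=
    Code.eval_part.comp (Computable.ofNat Code) Computable.id
  exact this.dom_re

/-- The s-m-n theorem: a program that halts on the pair `(n, m)` iff `n ∈ B`, whatever `m` is, is
curried at `n`; the result halts on its own code iff `n ∈ B`. -/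
theorem isCompleteSigma1_haltingSet : IsCompleteSigma1 haltingSet := by
  refine ⟨haltingSet_rePred, fun B hB => ?_⟩
  have hF : Nat.Partrec fun k : ℕ =>
      (Part.assert (k.unpair.1 ∈ B) fun _ => Part.some ()).map fun _ => 0 := by
    refine Partrec.nat_iff.1 (Partrec.map ?_ (Computable.const 0).to₂)
    exact Partrec.comp hB (Computable.fst.comp Computable.unpair)
  obtain ⟨c, hc⟩ := Code.exists_code.1 hF
  refine ⟨fun n => Encodable.encode (c.curry n), ?_, fun n => ?_⟩
  · exact Computable.encode.comp
      (Code.primrec₂_curry.to_comp.comp (Computable.const c) Computable.id)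
  · simp [haltingSet, Code.eval_curry, hc, Part.assert]

/-- The programs that halt on their own code within `s` steps. -/
def haltingStage (s : ℕ) : Set ℕ := {n | (Code.evaln s (Denumerable.ofNat Code n) n).isSome = true}

theorem isComputableEnumeration_haltingStage :
    IsComputableEnumeration haltingStage haltingSet := by
  refine ⟨?_, fun s t hst n hn => ?_, ?_⟩
  · refine ComputablePred.computable_iff.2
      ⟨fun p => (Code.evaln p.1 (Denumerable.ofNat Code p.2) p.2).isSome, ?_, rfl⟩
    exact Primrec.option_isSome.to_comp.comp (Code.primrec_evaln.to_comp.comp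
      ((Computable.fst.pair ((Computable.ofNat Code).comp Computable.snd)).pair Computable.snd))
  · obtain ⟨x, hx⟩ := Option.isSome_iff_exists.1 hn
    exact Option.isSome_iff_exists.2 ⟨x, Code.evaln_mono hst hx⟩
  · ext n
    simp only [Set.mem_iUnion, haltingStage, haltingSet, Set.mem_ofPred_eq, Part.dom_iff_mem,
      Code.evaln_complete, Option.isSome_iff_exists]
    exact exists_comm

end HaltingSet

/-! ### Computability of the coloring and decoding of solutions -/

section Coloring

theorem meet_length_computable : Computable₂ fun σ τ : List Bool => (meet σ τ).length := by
  have hfind : Primrec fun p : List Bool × List Bool =>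
      p.1.length.findGreatest fun k => k ≤ p.2.length ∧ p.1.take k = p.2.take k := by
    refine Primrec.nat_findGreatest (Primrec.list_length.comp Primrec.fst) ?_
    have hp : Primrec fun r : (List Bool × List Bool) × ℕ => r.1 := Primrec.fst
    have hk : Primrec fun r : (List Bool × List Bool) × ℕ => r.2 := Primrec.snd
    have h1 : PrimrecPred fun r : (List Bool × List Bool) × ℕ => r.2 ≤ r.1.2.length :=
      Primrec.nat_le.comp hk (Primrec.list_length.comp (Primrec.snd.comp hp))
    have h2 : PrimrecPred fun r : (List Bool × List Bool) × ℕ =>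
        r.1.1.take r.2 = r.1.2.take r.2 :=
      Primrec.eq.comp (Primrec.list_take.comp hk (Primrec.fst.comp hp))
        (Primrec.list_take.comp hk (Primrec.snd.comp hp))
    exact (h1.and h2).primrecRel
  refine hfind.to_comp.of_eq fun p => ?_
  rw [Nat.findGreatest_eq_iff]
  obtain ⟨h1, h2, h3⟩ := le_meet_length_iff.1 (le_refl (meet p.1 p.2).length)
  refine ⟨h1, fun _ => ⟨h2, h3⟩, fun k hk hk' ⟨h4, h5⟩ => ?_⟩
  exact absurd (le_meet_length_iff.2 ⟨hk', h4, h5⟩) (not_le.2 hk)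

theorem ltQ_computable : ComputablePred fun p : List Bool × List Bool => ltQ p.1 p.2 := by
  have hm : Computable fun p : List Bool × List Bool => (meet p.1 p.2).length :=
    meet_length_computable
  have hσ : Computable fun p : List Bool × List Bool => p.1[(meet p.1 p.2).length]? :=
    Primrec.list_getElem?.to_comp.comp Computable.fst hm
  have hτ : Computable fun p : List Bool × List Bool => p.2[(meet p.1 p.2).length]? :=
    Primrec.list_getElem?.to_comp.comp Computable.snd hm
  let f : Option Bool × Option Bool → Bool := fun q =>
    decide (q.1 = some false ∨ (q.1 = none ∧ q.2 = some true))
  have hf : Computable f := (Primrec.dom_finite f).to_comp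
  refine ComputablePred.computable_iff.2 ⟨_, hf.comp (hσ.pair hτ), funext fun p => ?_⟩
  simp only [f, decide_eq_true_eq, ltQ_iff_getElem?]

variable {e : ℚ ≃ List Bool} {A : ℕ → Set ℕ} {K : Set ℕ}

/-- A decision procedure for the agreement of two stages below `x`, from one for the stages. -/
def agreeBelow (a : ℕ × ℕ → Bool) (x y z : ℕ) : Bool :=
  x.rec true fun i b => b && (a (y, i) == a (z, i))

theorem agreeBelow_iff {a : ℕ × ℕ → Bool} (ha : ∀ s i, i ∈ A s ↔ a (s, i) = true) (x y z : ℕ) :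
    agreeBelow a x y z = true ↔ JockuschOne A x y z := by
  induction x with
  | zero => simp [agreeBelow, JockuschOne]
  | succ x ih =>
    have : agreeBelow a (x + 1) y z = (agreeBelow a x y z && (a (y, x) == a (z, x))) := rfl
    rw [this, Bool.and_eq_true, ih, beq_iff_eq, Bool.eq_iff_iff]
    simp only [JockuschOne, Nat.lt_succ_iff_lt_or_eq, or_imp, forall_and, forall_eq, ha]

theorem agreeBelow_computable {a : ℕ × ℕ → Bool} (ha : Computable a) :
    Computable fun p : ℕ × ℕ × ℕ => agreeBelow a p.1 p.2.1 p.2.2 := by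
  refine Computable.nat_rec (h := fun (p : ℕ × ℕ × ℕ) (q : ℕ × Bool) =>
    q.2 && (a (p.2.1, q.1) == a (p.2.2, q.1))) Computable.fst (Computable.const true) ?_
  have hq : Computable fun r : (ℕ × ℕ × ℕ) × ℕ × Bool => r.2.1 := Computable.fst.comp Computable.snd
  have hp : Computable fun r : (ℕ × ℕ × ℕ) × ℕ × Bool => r.1.2 := Computable.snd.comp Computable.fst
  refine Primrec.and.to_comp.comp (Computable.snd.comp Computable.snd) ?_
  exact (Primrec.beq (α := Bool)).to_comp.comp (ha.comp ((Computable.fst.comp hp).pair hq))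
    (ha.comp ((Computable.snd.comp hp).pair hq))

theorem IsComputableStringIso.isComputableColoring (he : IsComputableStringIso e)
    (hA : IsComputableEnumeration A K) :
    IsComputableColoring fun p q => productColoring A (e p) (e q) := by
  obtain ⟨hlt, g, hg, hge⟩ := he
  obtain ⟨a, ha, haA⟩ := ComputablePred.computable_iff.1 hA.1
  have haA' : ∀ s i, i ∈ A s ↔ a (s, i) = true := fun s i => iff_of_eq (congrFun haA (s, i))
  have hσ : Computable fun p : ℕ × ℕ => g p.1 := hg.comp Computable.fst
  have hτ : Computable fun p : ℕ × ℕ => g p.2 := hg.comp Computable.snd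
  have hσl := Computable.list_length.comp hσ
  have hτl := Computable.list_length.comp hτ
  have hm : Computable fun p : ℕ × ℕ => (meet (g p.1) (g p.2)).length :=
    Computable₂.comp meet_length_computable hσ hτ
  refine ⟨fun m n => cond (decide ((g m).length < (g n).length)) 2 0 +
    cond (agreeBelow a (meet (g m) (g n)).length (g m).length (g n).length) 1 0, ?_, ?_⟩
  · refine Primrec.nat_add.to_comp.comp (Computable.cond ?_ (.const 2) (.const 0))
      (Computable.cond ?_ (.const 1) (.const 0))
    · exact Primrec.nat_lt.decide.to_comp.comp hσl hτl
    · exact (agreeBelow_computable ha).comp (hm.pair (hσl.pair hτl))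
  · intro p q hpq
    classical
    simp only [hge, productColoring_of_ltQ ((hlt p q).1 hpq), ← agreeBelow_iff haA']
    by_cases h1 : (e p).length < (e q).length <;>
      cases h2 : agreeBelow a (meet (e p) (e q)).length (e p).length (e q).length <;> simp [h1]

/-- The halting set is reduced to `K` by `f`, and `f n ∈ K` is read off from a pair whose meet is
longer than `f n`. Which endpoint to trust depends on `S`, so the reduction is not uniform. -/
theorem IsDevlinSolution.computes_haltingSet (he : IsComputableStringIso e)
    (hK : IsCompleteSigma1 K) (hA : IsComputableEnumeration A K) {S : Set ℚ}
    (hS : IsDevlinSolution 3 (fun p q => productColoring A (e p) (e q)) S) :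
    RatSetComputes S haltingSet := by
  obtain ⟨hlt, g, hg, hge⟩ := he
  obtain ⟨f, hf, hfK⟩ := hK.2 _ haltingSet_rePred
  obtain ⟨a, ha, haA⟩ := ComputablePred.computable_iff.1 hA.1
  obtain ⟨l, hl, hlQ⟩ := ComputablePred.computable_iff.1 ltQ_computable
  have haA' : ∀ s i, i ∈ A s ↔ a (s, i) = true := fun s i => iff_of_eq (congrFun haA (s, i))
  have hlQ' : ∀ σ τ, ltQ σ τ ↔ l (σ, τ) = true := fun σ τ => iff_of_eq (congrFun hlQ (σ, τ))
  have hn : Computable fun t : ℕ × ℕ × ℕ => f t.1 := hf.comp Computable.fst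
  have hσ : Computable fun t : ℕ × ℕ × ℕ => g t.2.1 :=
    hg.comp (Computable.fst.comp Computable.snd)
  have hτ : Computable fun t : ℕ × ℕ × ℕ => g t.2.2 :=
    hg.comp (Computable.snd.comp Computable.snd)
  let test : ℕ × ℕ × ℕ → Bool := fun t =>
    l (g t.2.1, g t.2.2) && decide (f t.1 < (meet (g t.2.1) (g t.2.2)).length)
  have htest : Computable test := Primrec.and.to_comp.comp (hl.comp (hσ.pair hτ))
    (Primrec.nat_lt.decide.to_comp.comp hn (Computable₂.comp meet_length_computable hσ hτ))
  have htest_iff : ∀ n p q, test (n, ratCode p, ratCode q) = true ↔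
      p < q ∧ f n < (meet (e p) (e q)).length := by
    intro n p q
    simp only [test, hge, Bool.and_eq_true, decide_eq_true_eq, ← hlQ', ← hlt]
  have hex : ∀ n, ∃ b ∈ ratCode '' S, ∃ c ∈ ratCode '' S, test (n, b, c) = true := by
    intro n
    obtain ⟨p, hp, q, hq, hpq, hm⟩ := exists_lt_meet_length hS.2.1 hS.2.2.2.1 hS.1 e (f n)
    exact ⟨_, ⟨p, hp, rfl⟩, _, ⟨q, hq, rfl⟩, (htest_iff n p q).2 ⟨hpq, hm⟩⟩
  rcases hS.mem_stage_iff hlt hA.2.1 hA.2.2 with h | h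
  · refine SetTuringReducible.of_search (out := fun t => a ((g t.2.1).length, f t.1)) htest
      (ha.comp ((Computable.list_length.comp hσ).pair hn)) hex ?_
    rintro n _ ⟨p, hp, rfl⟩ _ ⟨q, hq, rfl⟩ ht
    obtain ⟨hpq, hm⟩ := (htest_iff n p q).1 ht
    simp only [hge, ← haA', h p hp q hq hpq _ hm, hfK]
  · refine SetTuringReducible.of_search (out := fun t => a ((g t.2.2).length, f t.1)) htest
      (ha.comp ((Computable.list_length.comp hτ).pair hn)) hex ?_
    rintro n _ ⟨p, hp, rfl⟩ _ ⟨q, hq, rfl⟩ ht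
    obtain ⟨hpq, hm⟩ := (htest_iff n p q).1 ht
    simp only [hge, ← haA', h p hp q hq hpq _ hm, hfK]

end Coloring

/-! ## The Stern–Brocot tree -/

section SternBrocot

/-- The positive rational at a node of the Stern–Brocot tree. -/
def sternBrocot : List Bool → ℚ
  | [] => 1
  | true :: σ => sternBrocot σ + 1
  | false :: σ => sternBrocot σ / (sternBrocot σ + 1)

theorem sternBrocot_nil : sternBrocot [] = 1 := rfl

theorem sternBrocot_pos (σ : List Bool) : 0 < sternBrocot σ := by
  induction σ with
  | nil => exact one_pos
  | cons b σ ih => cases b <;> simp only [sternBrocot] <;> positivity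

theorem sternBrocot_false_lt_one (σ : List Bool) : sternBrocot (false :: σ) < 1 := by
  have := sternBrocot_pos σ
  rw [sternBrocot, div_lt_one (by positivity)]
  exact lt_add_one _

theorem one_lt_sternBrocot_true (σ : List Bool) : 1 < sternBrocot (true :: σ) :=
  lt_add_of_pos_left _ (sternBrocot_pos σ)

/-- The maps `x ↦ x / (x + 1)` and `x ↦ x + 1` are increasing on the positive rationals, with values
below and above the root value 1; `ltQ` satisfies the same recursion. -/
theorem ltQ_iff_sternBrocot_lt {σ τ : List Bool} : ltQ σ τ ↔ sternBrocot σ < sternBrocot τ := by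
  induction σ generalizing τ with
  | nil =>
    match τ with
    | [] => simp
    | true :: τ => simpa [sternBrocot_nil] using one_lt_sternBrocot_true τ
    | false :: τ => simpa [sternBrocot_nil] using (sternBrocot_false_lt_one τ).le
  | cons a σ ih =>
    match a, τ with
    | true, [] => simpa [sternBrocot_nil] using (one_lt_sternBrocot_true σ).le
    | false, [] => simpa [sternBrocot_nil] using sternBrocot_false_lt_one σ
    | true, true :: τ => simp [sternBrocot, ih]
    | true, false :: τ =>
      simpa using ((sternBrocot_false_lt_one τ).trans (one_lt_sternBrocot_true σ)).le
    | false, true :: τ =>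
      simpa using (sternBrocot_false_lt_one σ).trans (one_lt_sternBrocot_true τ)
    | false, false :: τ =>
      have hσ := sternBrocot_pos σ
      have hτ := sternBrocot_pos τ
      simp only [ltQ_cons_cons, sternBrocot, ih, true_and, Bool.false_eq_true, and_false, false_or]
      rw [div_lt_div_iff₀ (by positivity) (by positivity)]
      constructor <;> intro h <;> linarith

theorem ltQ_trichotomy (σ τ : List Bool) : ltQ σ τ ∨ σ = τ ∨ ltQ τ σ := by
  induction σ generalizing τ with
  | nil =>
    match τ with
    | [] => simp
    | true :: τ => simp
    | false :: τ => simp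
  | cons a σ ih =>
    cases τ with
    | nil => cases a <;> simp
    | cons b τ => cases a <;> cases b <;> simp [ih]

theorem sternBrocot_injective : Function.Injective sternBrocot := by
  intro σ τ h
  rcases ltQ_trichotomy σ τ with h1 | h1 | h1
  · exact absurd h (ltQ_iff_sternBrocot_lt.1 h1).ne
  · exact h1
  · exact absurd h (ltQ_iff_sternBrocot_lt.1 h1).ne'

/-- The path to `a / b` in the Stern–Brocot tree, cut off after `n` steps. -/
def sternBrocotPath : ℕ → ℕ → ℕ → List Bool
  | 0, _, _ => []
  | n + 1, a, b =>
    if a < b then false :: sternBrocotPath n a (b - a)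
    else if b < a then true :: sternBrocotPath n (a - b) b
    else []

/-- The path is the run of the subtractive Euclidean algorithm; the sum of the entries drops at each
step, so `a + b` steps suffice. No coprimality is needed. -/
theorem sternBrocot_path {n a b : ℕ} (ha : 0 < a) (hb : 0 < b) (h : a + b ≤ n) :
    sternBrocot (sternBrocotPath n a b) = a / b := by
  induction n generalizing a b with
  | zero => omega
  | succ n ih =>
    have hb' : (b : ℚ) ≠ 0 := by positivity
    simp only [sternBrocotPath]
    split_ifs with h1 h2
    · have hne : (b : ℚ) - a ≠ 0 := sub_ne_zero.2 (by exact_mod_cast h1.ne')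
      rw [sternBrocot, ih ha (by omega) (by omega), Nat.cast_sub h1.le]
      have : (a : ℚ) / (b - a) + 1 = b / (b - a) := by field_simp; ring
      rw [this]
      field_simp
    · rw [sternBrocot, ih (by omega) hb (by omega), Nat.cast_sub h2.le]
      field_simp
      ring
    · have : a = b := by omega
      subst this
      simp [sternBrocot, hb']

/-- The recursion of `sternBrocotPath` changes its arguments; with an accumulator it becomes the
iteration of one function, which is primitive recursive. -/
def sternBrocotStep (s : ℕ × ℕ × List Bool) : ℕ × ℕ × List Bool :=
  if s.1 < s.2.1 then (s.1, s.2.1 - s.1, s.2.2 ++ [false])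
  else if s.2.1 < s.1 then (s.1 - s.2.1, s.2.1, s.2.2 ++ [true])
  else s

theorem sternBrocotStep_iterate (n a b : ℕ) (l : List Bool) :
    (sternBrocotStep^[n] (a, b, l)).2.2 = l ++ sternBrocotPath n a b := by
  induction n generalizing a b l with
  | zero => simp [sternBrocotPath]
  | succ n ih =>
    rw [Function.iterate_succ_apply]
    by_cases h1 : a < b
    · rw [sternBrocotStep, if_pos h1, ih]
      simp [sternBrocotPath, h1]
    · by_cases h2 : b < a
      · rw [sternBrocotStep, if_neg h1, if_pos h2, ih]
        simp [sternBrocotPath, h1, h2]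
      · rw [sternBrocotStep, if_neg h1, if_neg h2, ih]
        cases n <;> simp [sternBrocotPath, h1, h2]

theorem sternBrocotPath_primrec :
    Primrec fun p : ℕ × ℕ × ℕ => sternBrocotPath p.1 p.2.1 p.2.2 := by
  have ha : Primrec fun s : ℕ × ℕ × List Bool => s.1 := Primrec.fst
  have hb : Primrec fun s : ℕ × ℕ × List Bool => s.2.1 := Primrec.fst.comp Primrec.snd
  have hl : Primrec fun s : ℕ × ℕ × List Bool => s.2.2 := Primrec.snd.comp Primrec.snd
  have hstep : Primrec sternBrocotStep :=
    Primrec.ite (Primrec.nat_lt.comp ha hb)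
      (ha.pair ((Primrec.nat_sub.comp hb ha).pair (Primrec.list_append.comp hl (Primrec.const _))))
      (Primrec.ite (Primrec.nat_lt.comp hb ha) ((Primrec.nat_sub.comp ha hb).pair
        (hb.pair (Primrec.list_append.comp hl (Primrec.const _)))) Primrec.id)
  have hinit : Primrec fun p : ℕ × ℕ × ℕ => (p.2.1, p.2.2, ([] : List Bool)) :=
    (Primrec.fst.comp Primrec.snd).pair
      ((Primrec.snd.comp Primrec.snd).pair (Primrec.const []))
  refine (hl.comp (Primrec.nat_iterate Primrec.fst hinit
    (hstep.comp Primrec.snd).to₂)).of_eq fun p => ?_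
  rw [sternBrocotStep_iterate, List.nil_append]

/-- Numerator and denominator of the image of `q` under the order isomorphism of `ℚ` with the positive
rationals that sends `q ≥ 0` to `q + 1` and `q < 0` to `1 / (1 - q)`. -/
def posFrac (q : ℚ) : ℕ × ℕ :=
  if 0 ≤ q.num then (q.num.natAbs + q.den, q.den) else (q.den, q.num.natAbs + q.den)

theorem posFrac_pos (q : ℚ) : 0 < (posFrac q).1 ∧ 0 < (posFrac q).2 := by
  have := q.den_pos
  unfold posFrac
  split_ifs <;> constructor <;> simp only <;> omega

theorem posFrac_div (q : ℚ) :
    ((posFrac q).1 / (posFrac q).2 : ℚ) = if 0 ≤ q then q + 1 else 1 / (1 - q) := by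
  have hd : (q.den : ℚ) ≠ 0 := by exact_mod_cast q.den_nz
  have hq : (q.num : ℚ) = q * q.den := (Rat.mul_den_eq_num q).symm
  by_cases h : 0 ≤ q
  · have h' : 0 ≤ q.num := Rat.num_nonneg.2 h
    have habs : ((q.num.natAbs : ℕ) : ℚ) = q.num := by
      rw [Nat.cast_natAbs, abs_of_nonneg h']
    simp only [posFrac, if_pos h, if_pos h', Nat.cast_add, habs, hq]
    field_simp
  · have h' : ¬ 0 ≤ q.num := fun hc => h (Rat.num_nonneg.1 hc)
    have habs : ((q.num.natAbs : ℕ) : ℚ) = -q.num := by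
      rw [Nat.cast_natAbs, abs_of_neg (not_le.1 h'), Int.cast_neg]
    have hne : 1 - q ≠ 0 := by linarith [not_le.1 h]
    simp only [posFrac, if_neg h, if_neg h', Nat.cast_add, habs, hq]
    rw [show -(q * q.den) + q.den = (1 - q) * (q.den : ℚ) by ring]
    field_simp

theorem posFrac_div_strictMono :
    StrictMono fun q : ℚ => ((posFrac q).1 / (posFrac q).2 : ℚ) := by
  intro p q hpq
  simp only [posFrac_div]
  split_ifs with h1 h2 h2
  · linarith
  · exact absurd (h1.trans hpq.le) h2
  · have : 1 / (1 - p) < 1 := by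
      rw [div_lt_one (by linarith)]
      linarith
    linarith
  · exact one_div_lt_one_div_of_lt (by linarith) (by linarith)

theorem exists_posFrac_div_eq {x : ℚ} (hx : 0 < x) :
    ∃ q : ℚ, ((posFrac q).1 / (posFrac q).2 : ℚ) = x := by
  simp only [posFrac_div]
  by_cases h : 1 ≤ x
  · exact ⟨x - 1, by rw [if_pos (by linarith)]; ring⟩
  · have h1 : 1 < 1 / x := by
      rw [lt_div_iff₀ hx]
      linarith
    exact ⟨1 - 1 / x, by rw [if_neg (by linarith)]; field_simp; ring⟩

/-- The node of the Stern–Brocot tree that corresponds to a rational. -/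
def ratString (q : ℚ) : List Bool :=
  sternBrocotPath ((posFrac q).1 + (posFrac q).2) (posFrac q).1 (posFrac q).2

theorem sternBrocot_ratString (q : ℚ) :
    sternBrocot (ratString q) = (posFrac q).1 / (posFrac q).2 :=
  sternBrocot_path (posFrac_pos q).1 (posFrac_pos q).2 le_rfl

theorem lt_iff_ltQ_ratString {p q : ℚ} : p < q ↔ ltQ (ratString p) (ratString q) := by
  rw [ltQ_iff_sternBrocot_lt, sternBrocot_ratString, sternBrocot_ratString]
  exact posFrac_div_strictMono.lt_iff_lt.symm

theorem ratString_bijective : Function.Bijective ratString := by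
  constructor
  · intro p q h
    refine posFrac_div_strictMono.injective ?_
    simp only [← sternBrocot_ratString, h]
  · intro σ
    obtain ⟨q, hq⟩ := exists_posFrac_div_eq (sternBrocot_pos σ)
    exact ⟨q, sternBrocot_injective ((sternBrocot_ratString q).trans hq)⟩

theorem encode_int (k : ℤ) :
    Encodable.encode k = if 0 ≤ k then 2 * k.natAbs else 2 * k.natAbs - 1 := by
  cases k with
  | ofNat n => simp; rfl
  | negSucc n =>
    have : ¬ 0 ≤ Int.negSucc n := by simp
    rw [if_neg this]
    rfl

/-- `posFrac`, on codes. -/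
def posFracCode (c : ℕ) : ℕ × ℕ :=
  if c.unpair.1 % 2 = 0 then (c.unpair.1 / 2 + c.unpair.2, c.unpair.2)
  else (c.unpair.2, (c.unpair.1 + 1) / 2 + c.unpair.2)

theorem posFracCode_ratCode (q : ℚ) : posFracCode (ratCode q) = posFrac q := by
  unfold posFracCode ratCode posFrac
  simp only [Nat.unpair_pair, encode_int]
  by_cases h : 0 ≤ q.num
  · simp only [if_pos h, Nat.mul_mod_right, if_true]
    rw [Nat.mul_div_cancel_left _ two_pos]
  · have h1 : (2 * q.num.natAbs - 1) % 2 = 1 := by omega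
    have h2 : (2 * q.num.natAbs - 1 + 1) / 2 = q.num.natAbs := by omega
    simp only [if_neg h, h1, h2, one_ne_zero, if_false]

theorem posFracCode_primrec : Primrec posFracCode := by
  have h1 : Primrec fun c : ℕ => c.unpair.1 := Primrec.fst.comp Primrec.unpair
  have h2 : Primrec fun c : ℕ => c.unpair.2 := Primrec.snd.comp Primrec.unpair
  have hdiv : ∀ {f : ℕ → ℕ}, Primrec f → Primrec fun c => f c / 2 := fun hf =>
    Primrec.nat_div.comp hf (Primrec.const 2)
  refine Primrec.ite (Primrec.eq.comp (Primrec.nat_mod.comp h1 (Primrec.const 2)) (Primrec.const 0))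
    ((Primrec.nat_add.comp (hdiv h1) h2).pair h2) (h2.pair (Primrec.nat_add.comp (hdiv ?_) h2))
  exact Primrec.succ.comp h1

theorem exists_isComputableStringIso : ∃ e : ℚ ≃ List Bool, IsComputableStringIso e := by
  refine ⟨Equiv.ofBijective ratString ratString_bijective, fun p q => lt_iff_ltQ_ratString,
    fun c => sternBrocotPath ((posFracCode c).1 + (posFracCode c).2) (posFracCode c).1
      (posFracCode c).2, ?_, fun q => ?_⟩
  · have h1 := Primrec.fst.comp posFracCode_primrec
    have h2 := Primrec.snd.comp posFracCode_primrec
    exact (sternBrocotPath_primrec.comp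
      ((Primrec.nat_add.comp h1 h2).pair (h1.pair h2))).to_comp
  · simp only [posFracCode_ratCode, Equiv.ofBijective_apply, ratString]

end SternBrocot

theorem mainTheorem9 :
    -- a computable instance all of whose solutions compute the halting set
    (∃ f : ℚ → ℚ → Fin 4, IsComputableColoring f ∧
      ∀ S : Set ℚ, IsDevlinSolution 3 f S → RatSetComputes S haltingSet) ∧
    -- the explicit product coloring has this property
    (∃ e : ℚ ≃ List Bool, IsComputableStringIso e) ∧
    (∀ e : ℚ ≃ List Bool, IsComputableStringIso e →
      ∀ (K : Set ℕ) (A : ℕ → Set ℕ), IsCompleteSigma1 K → IsComputableEnumeration A K →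
        IsComputableColoring (fun p q => productColoring A (e p) (e q)) ∧
        ∀ S : Set ℚ, IsDevlinSolution 3 (fun p q => productColoring A (e p) (e q)) S →
          RatSetComputes S haltingSet) ∧
    -- the implication over the base theory, in all models
    (∀ (N : Type u) [CommSemiring N] [LinearOrder N] (𝒮 : Set (Set N)),
      ModelsRCA0 𝒮 → ModelsDT2 𝒮 4 3 → ModelsACA0 𝒮) := by
  have main : ∀ e : ℚ ≃ List Bool, IsComputableStringIso e →
      ∀ (K : Set ℕ) (A : ℕ → Set ℕ), IsCompleteSigma1 K → IsComputableEnumeration A K →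
        IsComputableColoring (fun p q => productColoring A (e p) (e q)) ∧
        ∀ S : Set ℚ, IsDevlinSolution 3 (fun p q => productColoring A (e p) (e q)) S →
          RatSetComputes S haltingSet :=
    fun e he K A hK hA => ⟨he.isComputableColoring hA, fun S hS => hS.computes_haltingSet he hK hA⟩
  obtain ⟨e, he⟩ := exists_isComputableStringIso
  exact ⟨⟨_, main e he _ _ isCompleteSigma1_haltingSet isComputableEnumeration_haltingStage⟩,
    ⟨e, he⟩, main, fun N _ _ 𝒮 hM hDT => hDT.modelsACA0 hM⟩
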